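/- **Proposition (Euler–Lagrange equations for elastic networks).** A regular $N$-network of class $H^2$ consists of $N$ curves $\gamma^i:[0,1]\to\mathbb R^2$ in $H^2$ with $\partial_x\gamma^i\neq0$ on $[0,1]$, whose end points meet in junctions (each end is attached to at least one other end) and whose union is connected. With $\partial_s=|\partial_x\gamma|^{-1}\partial_x$, let $\tau=\partial_s\gamma$, let $\nu$ be the counter-clockwise rotation of $\tau$ by $\pi/2$, let $\boldsymbol\kappa=\partial_s\tau=k\nu$ with $k$ the signed curvature, let $\partial_s^\perp\phi=\partial_s\phi-\langle\partial_s\phi,\tau\rangle\tau$, and let $$F_\delta(\Gamma)=\sum_{i=1}^N\int_{\gamma^i}(k^i)^2\,ds+\delta\sum_{i=1}^N\int_{\gamma^i}1\,ds .$$ A variation of $\Gamma$ is a family $\Gamma_t$ with curves $\gamma^i+\eta^i(t,\cdot)$, where $\eta^i$ is $C^\infty$ in $(t,x)$ and $\eta^i(0,\cdot)=0$, such that for all small $|t|$ the ends that meet in a junction remain attached. $\Gamma$ is stationary for $F_\delta$ if $\frac{d}{dt}F_\delta(\Gamma_t)|_{t=0}=0$ for all variations, and stationary with fixed angles if this holds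 for all variations that, for small $|t|$, keep the angles at the junctions between the tangents of the curves. Let $\delta>0$ and let $\Gamma$ be a regular $N$-network of class $H^2$ that is stationary for $F_\delta$, or only stationary with fixed angles. Then each curve $\gamma^i$ is of class $C^\infty$, that is, it admits a regular parametrization, with the same orientation, that is $C^\infty$ on $[0,1]$, and in this parametrization it satisfies on $(0,1)$ $$2(\partial_s^\perp)^2\boldsymbol\kappa^i+|\boldsymbol\kappa^i|^2\boldsymbol\kappa^i-\delta\boldsymbol\kappa^i=0 \qquad\text{and}\qquad 2\partial_s^2k^i+(k^i)^3-\delta k^i=0 .$$ Moreover, if $\Gamma$ is stationary with fixed angles, then at each junction in which exactly three ends of curves meet, with equal angles (of $120$ degrees), $$\sum_{i=1}^3k^i=0\qquad\text{and}\qquad\sum_{i=1}^3\bigl(2\,\partial_sk^i\,\nu^i+(k^i)^2\tau^i\bigr)=0 ,$$ where the sums run over the three ends and each curve is oriented so that it starts at the junction. -/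

import Mathlib

open Set Filter Topology MeasureTheory
open scoped ContDiff

noncomputable section

namespace ElasticNetwork

/-- The Euclidean plane. -/
abbrev Plane : Type := EuclideanSpace ℝ (Fin 2)

/-- The counter-clockwise rotation by a right angle. -/
def rot (v : Plane) : Plane := !₂[-(v 1), v 0]

/-- The derivative with respect to the parameter `x ∈ [0,1]` (one-sided at `0` and `1`). -/
def dx {V : Type*} [NormedAddCommGroup V] [NormedSpace ℝ V] (f : ℝ → V) : ℝ → V :=
  derivWithin f (Icc 0 1)

/-- The derivative with respect to arclength along `γ`, that is `|∂ₓγ|⁻¹ ∂ₓ`. -/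
def ds {V : Type*} [NormedAddCommGroup V] [NormedSpace ℝ V] (γ : ℝ → Plane) (f : ℝ → V) : ℝ → V :=
  fun x => ‖dx γ x‖⁻¹ • dx f x

/-- The normal component of `ds` on vector fields along `γ`. -/
def dsPerp (γ : ℝ → Plane) (f : ℝ → Plane) : ℝ → Plane :=
  fun x => ds γ f x - (inner ℝ (ds γ f x) (ds γ γ x)) • ds γ γ x

/-- The unit tangent vector. -/
def tangent (γ : ℝ → Plane) : ℝ → Plane := ds γ γ

/-- The unit normal vector. -/
def normal (γ : ℝ → Plane) : ℝ → Plane := fun x => rot (tangent γ x)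

/-- The curvature vector `∂ₛτ`. -/
def curvatureVector (γ : ℝ → Plane) : ℝ → Plane := ds γ (tangent γ)

/-- The (signed) scalar curvature `k`, so that the curvature vector is `k ν`. -/
def curvature (γ : ℝ → Plane) : ℝ → ℝ := fun x => inner ℝ (curvatureVector γ x) (normal γ x)

/-- `γ ∈ H²((0,1); ℝ²)`, for the continuously differentiable representative: `γ` is differentiable
on `[0,1]` and `∂ₓγ` is the indefinite integral of a square integrable function. -/
def IsH2 (γ : ℝ → Plane) : Prop :=
  DifferentiableOn ℝ γ (Icc 0 1) ∧
    ∃ g : ℝ → Plane, MemLp g 2 (volume.restrict (Icc (0 : ℝ) 1)) ∧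
      ∀ x ∈ Icc (0 : ℝ) 1, dx γ x = dx γ 0 + ∫ y in (0 : ℝ)..x, g y

/-- The parametrization `γ` is regular. -/
def IsRegular (γ : ℝ → Plane) : Prop := ∀ x ∈ Icc (0 : ℝ) 1, dx γ x ≠ 0

/-- The elastic energy `∫ k² ds`. -/
def elasticEnergy (γ : ℝ → Plane) : ℝ := ∫ x in (0 : ℝ)..1, curvature γ x ^ 2 * ‖dx γ x‖

/-- The length `∫ 1 ds`. -/
def length (γ : ℝ → Plane) : ℝ := ∫ x in (0 : ℝ)..1, ‖dx γ x‖

/-- The penalized energy `F_δ = E + δ L` of a family of curves. -/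
def energy {N : ℕ} (δ : ℝ) (γ : Fin N → ℝ → Plane) : ℝ :=
  (∑ i, elasticEnergy (γ i)) + δ * (∑ i, length (γ i))

/-- The ends of `N` curves: `(i, false)` is the end `x = 0` of the curve `i` and `(i, true)` is its
end `x = 1`. -/
abbrev CurveEnd (N : ℕ) : Type := Fin N × Bool

/-- The parameter of an end. -/
def endParam (b : Bool) : ℝ := if b then 1 else 0

/-- The sign that makes a curve start at the given end: `1` at `x = 0` and `-1` at `x = 1`. -/
def outward (b : Bool) : ℝ := if b then -1 else 1

variable {N : ℕ} {J : Type*}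

/-- The curves are attached to each other according to `junction`: ends that belong to the same
junction are at the same point. -/
def Attached (junction : CurveEnd N → J) (γ : Fin N → ℝ → Plane) : Prop :=
  ∀ e e' : CurveEnd N, junction e = junction e' →
    γ e.1 (endParam e.2) = γ e'.1 (endParam e'.2)

/-- The curves `γ`, whose ends meet in junctions as told by `junction`, form a regular `N`-network
of class `H²`. -/
structure IsRegularH2Network (junction : CurveEnd N → J) (γ : Fin N → ℝ → Plane) : Prop where
  isH2 : ∀ i, IsH2 (γ i)
  isRegular : ∀ i, IsRegular (γ i)
  attached : Attached junction γ
  /-- each end meets another end -/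
  meets : ∀ e, ∃ e', e' ≠ e ∧ junction e' = junction e
  connected : IsConnected (⋃ i, γ i '' Icc 0 1)

/-- The unit tangent vector at an end, pointing from the junction into the curve. -/
def outwardTangent (γ : Fin N → ℝ → Plane) (e : CurveEnd N) : Plane :=
  outward e.2 • tangent (γ e.1) (endParam e.2)

/-- All angles at the junctions are the same for `γ` and for `γ'`. -/
def SameAngles (junction : CurveEnd N → J) (γ γ' : Fin N → ℝ → Plane) : Prop :=
  ∀ e e' : CurveEnd N, junction e = junction e' →
    InnerProductGeometry.angle (outwardTangent γ' e) (outwardTangent γ' e') =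
      InnerProductGeometry.angle (outwardTangent γ e) (outwardTangent γ e')

/-- The perturbed curves `γⁱ + ηⁱ(t, ·)`. -/
def perturb (γ : Fin N → ℝ → Plane) (η : Fin N → ℝ → ℝ → Plane) (t : ℝ) : Fin N → ℝ → Plane :=
  fun i x => γ i x + η i t x

/-- `γⁱ + ηⁱ(t, ·)` is a variation of the network: `η` is smooth in `(t, x)`, vanishes for `t = 0`,
and the ends that meet in a junction remain attached. (For `t` near `0` the curves
remain regular and of class `H²`.) -/
structure IsVariation (junction : CurveEnd N → J) (γ : Fin N → ℝ → Plane)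
    (η : Fin N → ℝ → ℝ → Plane) : Prop where
  smooth : ∀ i, ContDiff ℝ ∞ (fun p : ℝ × ℝ => η i p.1 p.2)
  zero : ∀ i x, η i 0 x = 0
  attached : ∀ᶠ t in 𝓝 (0 : ℝ), Attached junction (perturb γ η t)

/-- Stationary for `F_δ` among the networks with the same junctions, the angles at the junctions
being free. -/
def IsFreelyStationary (δ : ℝ) (junction : CurveEnd N → J) (γ : Fin N → ℝ → Plane) : Prop :=
  ∀ η, IsVariation junction γ η → HasDerivAt (fun t => energy δ (perturb γ η t)) 0 0

/-- Stationary for `F_δ` among the networks with the same junctions and with the angles at the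
junctions fixed. -/
def IsStationaryFixedAngles (δ : ℝ) (junction : CurveEnd N → J) (γ : Fin N → ℝ → Plane) : Prop :=
  ∀ η, IsVariation junction γ η →
    (∀ᶠ t in 𝓝 (0 : ℝ), SameAngles junction γ (perturb γ η t)) →
    HasDerivAt (fun t => energy δ (perturb γ η t)) 0 0

/-- `σ` is a regular `C^∞` parametrization (up to the boundary) of the curve `γ`, with the same
orientation. -/
def IsSmoothParametrization (σ γ : ℝ → Plane) : Prop :=
  ContDiffOn ℝ ∞ σ (Icc 0 1) ∧ IsRegular σ ∧
    ∃ φ : ℝ → ℝ, ContDiffOn ℝ 1 φ (Icc 0 1) ∧ (∀ x ∈ Icc (0 : ℝ) 1, 0 < dx φ x) ∧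
      φ 0 = 0 ∧ φ 1 = 1 ∧ EqOn γ (σ ∘ φ) (Icc 0 1)

/-- `2 (∂ₛ^⊥)² κ + |κ|² κ - δ κ = 0` on `(0,1)`. -/
def VectorEulerLagrange (δ : ℝ) (γ : ℝ → Plane) : Prop :=
  ∀ x ∈ Ioo (0 : ℝ) 1,
    (2 : ℝ) • dsPerp γ (dsPerp γ (curvatureVector γ)) x
      + ‖curvatureVector γ x‖ ^ 2 • curvatureVector γ x - δ • curvatureVector γ x = 0

/-- `2 ∂ₛ² k + k³ - δ k = 0` on `(0,1)`. -/
def ScalarEulerLagrange (δ : ℝ) (γ : ℝ → Plane) : Prop :=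
  ∀ x ∈ Ioo (0 : ℝ) 1,
    2 * ds γ (ds γ (curvature γ)) x + curvature γ x ^ 3 - δ * curvature γ x = 0

open scoped Classical in
/-- The ends that meet in the junction `o`. -/
def endsAt (junction : CurveEnd N → J) (o : J) : Finset (CurveEnd N) :=
  Finset.univ.filter (fun e => junction e = o)

/-- Exactly three ends meet in `o`, and they form equal angles, that is, angles of 120 degrees. -/
def IsEqualAngleTriple (junction : CurveEnd N → J) (γ : Fin N → ℝ → Plane) (o : J) : Prop :=
  (endsAt junction o).card = 3 ∧
    ∀ e ∈ endsAt junction o, ∀ e' ∈ endsAt junction o, e ≠ e' →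
      InnerProductGeometry.angle (outwardTangent γ e) (outwardTangent γ e') = 2 * Real.pi / 3

/-- `∑ k = 0` and `∑ (2 ∂ₛk ν + k² τ) = 0` over the ends that meet in `o`, where each of the curves
is oriented so that it starts in `o`. Reversing the orientation changes the signs of `k`, `τ`, `ν`
and keeps `∂ₛk`, so the terms that come from the ends `x = 1` get the sign `-1`. -/
def JunctionConditions (junction : CurveEnd N → J) (γ : Fin N → ℝ → Plane) (o : J) : Prop :=
  ∑ e ∈ endsAt junction o, outward e.2 * curvature (γ e.1) (endParam e.2) = 0 ∧
  ∑ e ∈ endsAt junction o,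
    outward e.2 • ((2 * ds (γ e.1) (curvature (γ e.1)) (endParam e.2)) •
        normal (γ e.1) (endParam e.2)
      + curvature (γ e.1) (endParam e.2) ^ 2 • tangent (γ e.1) (endParam e.2)) = 0

end ElasticNetwork

end

open ElasticNetwork

/-! In terms of the velocity `p` and the acceleration `q` the energy density is `⟪Jp, q⟫² / |p|⁵ + δ
|p|`, with `J` the rotation by a right angle. It is quadratic in `q`, so dominated convergence gives
the first variation of an `H²` curve along any smooth field (`IsH2Data.hasDerivAt_energy`).

Fields that vanish to first order at both ends of one curve are admissible even with fixed angles.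
The second-order lemma of Du Bois-Reymond (`exists_hasACDeriv_of_forall_flatTest`) turns
stationarity against them into `(∂_q f)' = ∂_p f + c` for the density `f` and a constant vector `c`,
where `∂_q f` has an absolutely continuous representative. Multiplied by the speed, this is an
equation for `2kν` whose right-hand side involves only the speed, the tangent, the curvature and `c`
(`gradVel_identity`). Its normal and tangential components give `c = (k² - δ)τ + 2 ∂ₛk ν`: a
conserved force.

In the parametrization of constant speed, `(k, τ)` therefore solves an autonomous system with
polynomial right-hand side, hence is smooth. Differentiating `⟪c, ν⟫ = 2 ∂ₛk` along the curve gives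
both Euler–Lagrange equations (`IsH2Data.exists_isElastica`, `IsElastica.contDiffOn`,
`IsH2Data.exists_smoothParametrization`).

What remains of the first variation is boundary terms. Translating a junction balances the forces
`c`; turning all tangents at a junction at one common rate balances the curvatures
(`junction_balance`). At a triple junction with equal angles the unit tangents sum to zero, which
removes the `δτ` part of `c`. Free stationarity implies stationarity with fixed angles, so one
argument serves both cases. -/

noncomputable section

namespace ElasticNetwork

/-! ### Linear algebra of the plane and its quarter turn -/

/-- The rotation by a right angle as a continuous linear map. -/
def rotL : Plane →L[ℝ] Plane :=
  LinearMap.toContinuousLinearMap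
    { toFun := rot
      map_add' := fun u v => by
        ext i; fin_cases i <;> (simp [rot]; try ring)
      map_smul' := fun a v => by
        ext i; fin_cases i <;> simp [rot] }

theorem rotL_apply (v : Plane) : rotL v = rot v := rfl

@[simp] theorem rotL_zero_coord (v : Plane) : rotL v 0 = -v 1 := by simp [rotL_apply, rot]

@[simp] theorem rotL_one_coord (v : Plane) : rotL v 1 = v 0 := by simp [rotL_apply, rot]

/-- The coordinates as continuous linear maps. -/
def coordL (i : Fin 2) : Plane →L[ℝ] ℝ := EuclideanSpace.proj i

@[simp] theorem coordL_apply (i : Fin 2) (v : Plane) : coordL i v = v i := rfl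

theorem inner_eq_coord (u v : Plane) : inner ℝ u v = u 0 * v 0 + u 1 * v 1 := by
  simp [PiLp.inner_apply, mul_comm]

theorem norm_sq_eq_coord (u : Plane) : ‖u‖ ^ 2 = u 0 ^ 2 + u 1 ^ 2 := by
  rw [← real_inner_self_eq_norm_sq, inner_eq_coord]; ring

theorem inner_rotL_left (u v : Plane) : inner ℝ (rotL u) v = -inner ℝ u (rotL v) := by
  simp [inner_eq_coord]

theorem inner_rotL_rotL (u v : Plane) : inner ℝ (rotL u) (rotL v) = inner ℝ u v := by
  simp [inner_eq_coord]; ring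

theorem inner_self_rotL (u : Plane) : inner ℝ u (rotL u) = 0 := by
  simp [inner_eq_coord]; ring

theorem inner_rotL_self (u : Plane) : inner ℝ (rotL u) u = 0 := by
  simp [inner_eq_coord]; ring

theorem norm_rotL (u : Plane) : ‖rotL u‖ = ‖u‖ := by
  rw [← sq_eq_sq₀ (norm_nonneg _) (norm_nonneg _), norm_sq_eq_coord, norm_sq_eq_coord]
  simp [add_comm]

theorem rotL_rotL (u : Plane) : rotL (rotL u) = -u := by
  ext i; fin_cases i <;> simp

/-- `p` and `rotL p` are orthogonal and of equal length. The factor `‖p‖ ^ 2` avoids a division and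
the hypothesis `p ≠ 0`. -/
theorem norm_sq_smul_eq (p v : Plane) :
    ‖p‖ ^ 2 • v = inner ℝ p v • p + inner ℝ (rotL p) v • rotL p := by
  ext i; fin_cases i <;> simp [norm_sq_eq_coord, inner_eq_coord] <;> ring

/-! ### Calculus of absolutely continuous functions on the unit interval -/

/-- `f` is absolutely continuous on `[0,1]` with almost everywhere derivative `f'`. -/
structure HasACDeriv {E : Type*} [NormedAddCommGroup E] [NormedSpace ℝ E] (f f' : ℝ → E) :
    Prop where
  ac : AbsolutelyContinuousOnInterval f 0 1
  integrable : IntervalIntegrable f' volume 0 1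
  ae_hasDerivAt : ∀ᵐ x, x ∈ Ioo (0 : ℝ) 1 → HasDerivAt f (f' x) x

theorem ae_ne_zero_one : ∀ᵐ x : ℝ, x ≠ 0 ∧ x ≠ 1 := by
  have h0 : ∀ᵐ x : ℝ, x ≠ 0 := by simp [ae_iff, measure_singleton]
  have h1 : ∀ᵐ x : ℝ, x ≠ 1 := by simp [ae_iff, measure_singleton]
  filter_upwards [h0, h1] with x a b using ⟨a, b⟩

/-- The Lipschitz bound is asked only on the image of the interval, because the square root and the
inverse are Lipschitz only away from `0`. -/
theorem absolutelyContinuousOnInterval_lipschitz_comp {X Y : Type*} [PseudoMetricSpace X]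
    [PseudoMetricSpace Y] {f : ℝ → X} {a b : ℝ} (hf : AbsolutelyContinuousOnInterval f a b)
    {Φ : X → Y} {C : NNReal} (hΦ : LipschitzOnWith C Φ (f '' uIcc a b)) :
    AbsolutelyContinuousOnInterval (Φ ∘ f) a b := by
  rw [absolutelyContinuousOnInterval_iff] at hf ⊢
  intro ε hε
  -- `C + 1` instead of `C` covers `C = 0` and makes the final inequality strict.
  obtain ⟨δ, hδ, h⟩ := hf (ε / (C + 1)) (by positivity)
  refine ⟨δ, hδ, fun E hE hs => ?_⟩
  have hlt := h E hE hs
  have hm : ∀ i ∈ Finset.range E.1, (E.2 i).1 ∈ uIcc a b ∧ (E.2 i).2 ∈ uIcc a b := hE.1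
  calc ∑ i ∈ Finset.range E.1, dist ((Φ ∘ f) (E.2 i).1) ((Φ ∘ f) (E.2 i).2)
      ≤ ∑ i ∈ Finset.range E.1, (C : ℝ) * dist (f (E.2 i).1) (f (E.2 i).2) :=
        Finset.sum_le_sum fun i hi => hΦ.dist_le_mul _ (mem_image_of_mem _ (hm i hi).1) _
          (mem_image_of_mem _ (hm i hi).2)
    _ = C * ∑ i ∈ Finset.range E.1, dist (f (E.2 i).1) (f (E.2 i).2) := by rw [Finset.mul_sum]
    _ ≤ C * (ε / (C + 1)) := by gcongr
    _ < ε := by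
        rw [mul_div_assoc', div_lt_iff₀ (by positivity)]
        nlinarith

namespace HasACDeriv

variable {E F : Type*} [NormedAddCommGroup E] [NormedSpace ℝ E] [NormedAddCommGroup F]
  [NormedSpace ℝ F] {f f' g g' : ℝ → E}

theorem continuousOn (h : HasACDeriv f f') : ContinuousOn f (Icc 0 1) := by
  simpa [uIcc_of_le] using h.ac.continuousOn

theorem continuousOn_uIcc (h : HasACDeriv f f') : ContinuousOn f (uIcc 0 1) := h.ac.continuousOn

theorem congr_deriv (h : HasACDeriv f f') (hg : ∀ᵐ x, x ∈ Ioo (0 : ℝ) 1 → f' x = g' x) :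
    HasACDeriv f g' := by
  refine ⟨h.ac, h.integrable.congr_ae ?_, ?_⟩
  · rw [EventuallyEq, ae_restrict_iff' measurableSet_uIoc]
    filter_upwards [hg, ae_ne_zero_one] with x hx hx' hm
    rw [uIoc_of_le zero_le_one] at hm
    exact hx ⟨hm.1, lt_of_le_of_ne hm.2 hx'.2⟩
  · filter_upwards [hg, h.ae_hasDerivAt] with x hx hd hm
    rw [← hx hm]; exact hd hm

theorem clm_comp (h : HasACDeriv f f') (L : E →L[ℝ] F) :
    HasACDeriv (fun x => L (f x)) (fun x => L (f' x)) := by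
  refine ⟨absolutelyContinuousOnInterval_lipschitz_comp h.ac L.lipschitz.lipschitzOnWith, ?_, ?_⟩
  · exact ⟨L.integrable_comp h.integrable.1, L.integrable_comp h.integrable.2⟩
  · filter_upwards [h.ae_hasDerivAt] with x hx hm
    exact L.hasFDerivAt.comp_hasDerivAt x (hx hm)

theorem add (hf : HasACDeriv f f') (hg : HasACDeriv g g') :
    HasACDeriv (fun x => f x + g x) (fun x => f' x + g' x) := by
  refine ⟨hf.ac.fun_add hg.ac, hf.integrable.add hg.integrable, ?_⟩
  filter_upwards [hf.ae_hasDerivAt, hg.ae_hasDerivAt] with x h1 h2 hm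
  exact (h1 hm).add (h2 hm)

theorem smul {r r' : ℝ → ℝ} (hr : HasACDeriv r r') (hf : HasACDeriv f f') :
    HasACDeriv (fun x => r x • f x) (fun x => r x • f' x + r' x • f x) := by
  refine ⟨hr.ac.fun_smul hf.ac, ?_, ?_⟩
  · exact (hf.integrable.continuousOn_smul hr.continuousOn_uIcc).add
      (hr.integrable.smul_continuousOn hf.continuousOn_uIcc)
  · filter_upwards [hf.ae_hasDerivAt, hr.ae_hasDerivAt] with x h1 h2 hm
    exact (h2 hm).smul (h1 hm)

theorem of_hasDerivAt (h : ∀ x, HasDerivAt f (f' x) x) (hf' : Continuous f') :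
    HasACDeriv f f' := by
  refine ⟨ContDiffOn.absolutelyContinuousOnInterval (ContDiff.contDiffOn ?_),
    hf'.intervalIntegrable 0 1, ae_of_all _ fun x _ => h x⟩
  rw [contDiff_one_iff_deriv]
  exact ⟨fun x => (h x).differentiableAt, by rwa [funext fun x => (h x).deriv]⟩

theorem eq_integral_real {f f' : ℝ → ℝ} (h : HasACDeriv f f') {x : ℝ} (hx : x ∈ Icc (0 : ℝ) 1) :
    f x = f 0 + ∫ y in (0 : ℝ)..x, f' y := by
  have hac := h.ac.mono (c := 0) (d := x) (by
    rw [uIcc_of_le hx.1, uIcc_of_le zero_le_one]; exact Icc_subset_Icc_right hx.2)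
  have := hac.integral_deriv_eq_sub
  rw [← sub_eq_iff_eq_add', ← this]
  apply intervalIntegral.integral_congr_ae
  filter_upwards [h.ae_hasDerivAt, ae_ne_zero_one] with y hy hy' hm
  rw [uIoc_of_le hx.1] at hm
  exact (hy ⟨hm.1, lt_of_le_of_ne (hm.2.trans hx.2) hy'.2⟩).deriv

theorem eq_integral {f f' : ℝ → Plane} (h : HasACDeriv f f') {x : ℝ} (hx : x ∈ Icc (0 : ℝ) 1) :
    f x = f 0 + ∫ y in (0 : ℝ)..x, f' y := by
  have hint : IntervalIntegrable f' volume 0 x := h.integrable.mono_set (by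
    rw [uIcc_of_le hx.1, uIcc_of_le zero_le_one]; exact Icc_subset_Icc_right hx.2)
  ext i
  have := (h.clm_comp (coordL i)).eq_integral_real hx
  rw [(coordL i).intervalIntegral_comp_comm hint]
    at this
  simpa using this

theorem of_integral_real {f f' : ℝ → ℝ} (hint : IntervalIntegrable f' volume 0 1)
    (h : ∀ x ∈ Icc (0 : ℝ) 1, f x = f 0 + ∫ y in (0 : ℝ)..x, f' y) : HasACDeriv f f' := by
  have hc : AbsolutelyContinuousOnInterval (fun _ : ℝ => f 0) 0 1 :=
    ContDiffOn.absolutelyContinuousOnInterval contDiffOn_const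
  have hac := hc.fun_add (hint.absolutelyContinuousOnInterval_intervalIntegral (c := 0) (by simp))
  refine ⟨?_, hint, ?_⟩
  · rw [absolutelyContinuousOnInterval_iff] at hac ⊢
    intro ε hε
    obtain ⟨δ, hδ, hE⟩ := hac ε hε
    refine ⟨δ, hδ, fun I hI hs => ?_⟩
    have := hE I hI hs
    -- `f` is arbitrary off `[0,1]`, but only values at endpoints inside `[0,1]` enter the sums.
    have hm : ∀ i ∈ Finset.range I.1, (I.2 i).1 ∈ uIcc (0 : ℝ) 1 ∧ (I.2 i).2 ∈ uIcc (0 : ℝ) 1 :=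
      hI.1
    rw [uIcc_of_le zero_le_one] at hm
    refine lt_of_eq_of_lt (Finset.sum_congr rfl fun i hi => ?_) this
    rw [← h _ (hm i hi).1, ← h _ (hm i hi).2]
  · filter_upwards [hint.ae_hasDerivAt_integral] with x hx hm
    have := hx (by rw [uIcc_of_le zero_le_one]; exact ⟨hm.1.le, hm.2.le⟩) 0 (by simp)
    refine (this.const_add (f 0)).congr_of_eventuallyEq ?_
    filter_upwards [Ioo_mem_nhds hm.1 hm.2] with y hy
    exact h y ⟨hy.1.le, hy.2.le⟩

theorem of_integral {f f' : ℝ → Plane} (hint : IntervalIntegrable f' volume 0 1)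
    (h : ∀ x ∈ Icc (0 : ℝ) 1, f x = f 0 + ∫ y in (0 : ℝ)..x, f' y) : HasACDeriv f f' := by
  have hi : ∀ i : Fin 2, HasACDeriv (fun x => f x i) (fun x => f' x i) := by
    intro i
    let L := coordL i
    refine of_integral_real ⟨L.integrable_comp hint.1, L.integrable_comp hint.2⟩ fun x hx => ?_
    have hint' : IntervalIntegrable f' volume 0 x := hint.mono_set (by
      rw [uIcc_of_le hx.1, uIcc_of_le zero_le_one]; exact Icc_subset_Icc_right hx.2)
    have := L.intervalIntegral_comp_comm hint'
    have h2 := congrArg L (h x hx)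
    rw [map_add, ← this] at h2
    exact h2
  have h2 := ((hi 0).clm_comp (ContinuousLinearMap.toSpanSingleton ℝ (!₂[1, 0] : Plane))).add
    ((hi 1).clm_comp (ContinuousLinearMap.toSpanSingleton ℝ (!₂[0, 1] : Plane)))
  convert h2 using 2 <;> (ext i; fin_cases i <;> simp)

theorem inner_plane {f f' g g' : ℝ → Plane} (hf : HasACDeriv f f') (hg : HasACDeriv g g') :
    HasACDeriv (fun x => inner ℝ (f x) (g x))
      (fun x => inner ℝ (f x) (g' x) + inner ℝ (f' x) (g x)) := by
  have hp : ∀ i : Fin 2, ∀ {u u' : ℝ → Plane}, HasACDeriv u u' →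
      HasACDeriv (fun x => u x i) (fun x => u' x i) := fun i _ _ h =>
    h.clm_comp (coordL i)
  have h2 := ((hp 0 hf).smul (hp 0 hg)).add ((hp 1 hf).smul (hp 1 hg))
  convert h2 using 2
  · simp [inner_eq_coord]
  · simp [inner_eq_coord]; ring

/-- A `C¹` function is locally Lipschitz, hence Lipschitz on the compact image of `r`. -/
theorem real_comp {r r' : ℝ → ℝ} (hr : HasACDeriv r r') {Φ : ℝ → ℝ} {U : Set ℝ} (hU : IsOpen U)
    (hrU : ∀ x ∈ Icc (0 : ℝ) 1, r x ∈ U) (hΦ : ContDiffOn ℝ 1 Φ U) :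
    HasACDeriv (fun x => Φ (r x)) (fun x => deriv Φ (r x) * r' x) := by
  have hrU' : MapsTo r (uIcc 0 1) U := by rwa [uIcc_of_le zero_le_one]
  have hloc : LocallyLipschitzOn (r '' uIcc 0 1) Φ := by
    rintro _ ⟨x, hx, rfl⟩
    obtain ⟨C, t, ht, hC⟩ := (hΦ.contDiffAt (hU.mem_nhds (hrU' hx))).exists_lipschitzOnWith
    exact ⟨C, t, mem_nhdsWithin_of_mem_nhds ht, hC⟩
  obtain ⟨C, hC⟩ := hloc.exists_lipschitzOnWith_of_compact
    (isCompact_uIcc.image_of_continuousOn hr.continuousOn_uIcc)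
  refine ⟨absolutelyContinuousOnInterval_lipschitz_comp hr.ac hC, ?_, ?_⟩
  · exact hr.integrable.continuousOn_mul
      ((hΦ.continuousOn_deriv_of_isOpen hU le_rfl).comp hr.continuousOn_uIcc hrU')
  · filter_upwards [hr.ae_hasDerivAt] with x hx hm
    have := hrU x ⟨hm.1.le, hm.2.le⟩
    exact (((hΦ.contDiffAt (hU.mem_nhds this)).differentiableAt one_ne_zero).hasDerivAt).comp x
      (hx hm)

theorem norm_plane {P G : ℝ → Plane} (h : HasACDeriv P G) (h0 : ∀ x ∈ Icc (0 : ℝ) 1, P x ≠ 0) :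
    HasACDeriv (fun x => ‖P x‖) (fun x => inner ℝ (P x) (G x) / ‖P x‖) := by
  have h1 := (h.inner_plane h).real_comp (Φ := Real.sqrt) isOpen_compl_singleton
    (fun x hx => by simpa using h0 x hx)
    (fun y hy => (Real.contDiffAt_sqrt hy).contDiffWithinAt)
  have h2 : (fun x => ‖P x‖) = fun x => Real.sqrt (inner ℝ (P x) (P x)) := by
    ext x; rw [real_inner_self_eq_norm_sq, Real.sqrt_sq (norm_nonneg _)]
  rw [h2]
  refine h1.congr_deriv (ae_of_all _ fun x hx => ?_)
  have hx0 := norm_ne_zero_iff.2 (h0 x ⟨hx.1.le, hx.2.le⟩)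
  have hd := (Real.hasDerivAt_sqrt (x := inner ℝ (P x) (P x))
    (by simpa using hx0)).deriv
  rw [hd, real_inner_self_eq_norm_sq, Real.sqrt_sq (norm_nonneg _), real_inner_comm (P x) (G x)]
  field_simp
  ring

theorem norm_inv_plane {P G : ℝ → Plane} (h : HasACDeriv P G) (h0 : ∀ x ∈ Icc (0 : ℝ) 1, P x ≠ 0) :
    HasACDeriv (fun x => ‖P x‖⁻¹) (fun x => -inner ℝ (P x) (G x) / ‖P x‖ ^ 3) := by
  have h1 := (h.norm_plane h0).real_comp (Φ := Inv.inv) isOpen_compl_singleton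
    (fun x hx => by simpa using h0 x hx)
    (fun y hy => (contDiffAt_inv ℝ hy).contDiffWithinAt)
  refine h1.congr_deriv (ae_of_all _ fun x hx => ?_)
  have hx0 := norm_ne_zero_iff.2 (h0 x ⟨hx.1.le, hx.2.le⟩)
  rw [deriv_inv]
  field_simp

/-- The unit tangent of an absolutely continuous velocity. -/
theorem normalize {P G : ℝ → Plane} (h : HasACDeriv P G) (h0 : ∀ x ∈ Icc (0 : ℝ) 1, P x ≠ 0) :
    HasACDeriv (fun x => ‖P x‖⁻¹ • P x)
      (fun x => (inner ℝ (rotL (P x)) (G x) / ‖P x‖ ^ 3) • rotL (P x)) := by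
  refine ((h.norm_inv_plane h0).smul h).congr_deriv (ae_of_all _ fun x hx => ?_)
  have hx0 := norm_ne_zero_iff.2 (h0 x ⟨hx.1.le, hx.2.le⟩)
  -- Split `G` along `P` and `rotL P`: the derivative of `‖P‖⁻¹` cancels the tangential part.
  have h2 : G x = (‖P x‖ ^ 2)⁻¹ • (inner ℝ (P x) (G x) • P x
      + inner ℝ (rotL (P x)) (G x) • rotL (P x)) := by
    rw [← norm_sq_smul_eq, smul_smul, inv_mul_cancel₀ (by positivity), one_smul]
  have h3 : ‖P x‖⁻¹ • G x = (inner ℝ (P x) (G x) / ‖P x‖ ^ 3) • P x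
      + (inner ℝ (rotL (P x)) (G x) / ‖P x‖ ^ 3) • rotL (P x) := by
    conv_lhs => rw [h2]
    simp only [smul_add, smul_smul]
    congr 2 <;> field_simp
  rw [h3]
  module

/-- Integration by parts for the inner product. -/
theorem integral_inner_eq {f f' g g' : ℝ → Plane} (hf : HasACDeriv f f') (hg : HasACDeriv g g') :
    ∫ x in (0 : ℝ)..1, (inner ℝ (f x) (g' x) + inner ℝ (f' x) (g x)) =
      inner ℝ (f 1) (g 1) - inner ℝ (f 0) (g 0) := by
  have := (hf.inner_plane hg).eq_integral_real (x := 1) (by simp)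
  linarith

end HasACDeriv

/-! ### Test functions and the second-order Du Bois-Reymond lemma -/

/-- A smooth function on `ℝ` that vanishes to first order at `0` and `1`. -/
structure IsFlatTest (ψ : ℝ → Plane) : Prop where
  smooth : ContDiff ℝ ∞ ψ
  zero : ψ 0 = 0
  one : ψ 1 = 0
  deriv_zero : deriv ψ 0 = 0
  deriv_one : deriv ψ 1 = 0

theorem contDiff_primitive {w : ℝ → ℝ} (hw : ContDiff ℝ ∞ w) :
    ContDiff ℝ ∞ (fun x => ∫ y in (0 : ℝ)..x, w y) ∧
      deriv (fun x => ∫ y in (0 : ℝ)..x, w y) = w := by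
  have h : ∀ x, HasDerivAt (fun x => ∫ y in (0 : ℝ)..x, w y) (w x) x := fun x =>
    hw.continuous.integral_hasStrictDerivAt 0 x |>.hasDerivAt
  have h2 : deriv (fun x => ∫ y in (0 : ℝ)..x, w y) = w := funext fun x => (h x).deriv
  refine ⟨?_, h2⟩
  rw [contDiff_infty_iff_deriv, h2]
  exact ⟨fun x => (h x).differentiableAt, hw⟩

/-- Primitives from `0` vanish there. At `1` the first primitive is the zeroth moment, and the
second is, by parts, the zeroth moment minus the first. -/
theorem exists_double_primitive {w : ℝ → ℝ} (hw : ContDiff ℝ ∞ w)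
    (h0 : ∫ x in (0 : ℝ)..1, w x = 0) (h1 : ∫ x in (0 : ℝ)..1, x * w x = 0) :
    ∃ ψ : ℝ → ℝ, ContDiff ℝ ∞ ψ ∧ ψ 0 = 0 ∧ ψ 1 = 0 ∧ deriv ψ 0 = 0 ∧ deriv ψ 1 = 0 ∧
      deriv (deriv ψ) = w := by
  obtain ⟨s1, d1⟩ := contDiff_primitive hw
  obtain ⟨s2, d2⟩ := contDiff_primitive s1
  refine ⟨_, s2, by simp, ?_, by rw [d2]; simp, by rw [d2]; exact h0, by rw [d2, d1]⟩
  have := intervalIntegral.integral_mul_deriv_eq_deriv_mul (a := 0) (b := 1)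
    (u := fun x : ℝ => x) (u' := fun _ => 1) (v := fun x => ∫ y in (0 : ℝ)..x, w y) (v' := w)
    (fun x _ => hasDerivAt_id x)
    (fun x _ => hw.continuous.integral_hasStrictDerivAt 0 x |>.hasDerivAt)
    (by simp) (hw.continuous.intervalIntegrable 0 1)
  simp only [h1, h0, one_mul, zero_mul, mul_zero] at this
  linarith

theorem integral_affine_mul (a b : ℝ) :
    ∫ x in (0 : ℝ)..1, (a + b * x) = a + b / 2 := by
  rw [intervalIntegral.integral_add (by simp) (by apply Continuous.intervalIntegrable; fun_prop),
    intervalIntegral.integral_const_mul]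
  simp; ring

theorem integral_mul_affine_mul (a b : ℝ) :
    ∫ x in (0 : ℝ)..1, x * (a + b * x) = a / 2 + b / 3 := by
  have : ∀ x : ℝ, x * (a + b * x) = a * x + b * x ^ 2 := fun x => by ring
  simp_rw [this]
  rw [intervalIntegral.integral_add (by apply Continuous.intervalIntegrable; fun_prop)
    (by apply Continuous.intervalIntegrable; fun_prop),
    intervalIntegral.integral_const_mul, intervalIntegral.integral_const_mul]
  simp; ring

/-- A function that is orthogonal to all second derivatives of test functions is affine. -/
theorem ae_eq_affine_of_forall_flatTest {H : ℝ → Plane} (hH : IntervalIntegrable H volume 0 1)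
    (h : ∀ ψ, IsFlatTest ψ → ∫ x in (0 : ℝ)..1, inner ℝ (H x) (deriv (deriv ψ) x) = 0) :
    ∃ c d : Plane, ∀ᵐ x, x ∈ Ioo (0 : ℝ) 1 → H x = d + x • c := by
  set H0 := ∫ x in (0 : ℝ)..1, H x with hH0
  set H1 := ∫ x in (0 : ℝ)..1, x • H x with hH1
  have hxH : IntervalIntegrable (fun x => x • H x) volume 0 1 :=
    hH.continuousOn_smul continuousOn_id
  -- The `L²` projection of `H` to affine functions. The coefficients are the entries of the inverse
  -- of the Gram matrix `(1, 1/2; 1/2, 1/3)` of `1, x`.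
  refine ⟨(12 : ℝ) • H1 - (6 : ℝ) • H0, (4 : ℝ) • H0 - (6 : ℝ) • H1, ?_⟩
  set c := (12 : ℝ) • H1 - (6 : ℝ) • H0 with hc
  set d := (4 : ℝ) • H0 - (6 : ℝ) • H1 with hd
  have haff : Continuous fun x : ℝ => d + x • c := by fun_prop
  have key : ∀ᵐ x, x ∈ Ioo (0 : ℝ) 1 → H x - (d + x • c) = 0 := by
    have hint : IntervalIntegrable (fun x => H x - (d + x • c)) volume 0 1 :=
      hH.sub (haff.intervalIntegrable 0 1)
    refine isOpen_Ioo.ae_eq_zero_of_integral_contDiff_smul_eq_zero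
      (IntegrableOn.locallyIntegrableOn
        ((intervalIntegrable_iff_integrableOn_Ioo_of_le zero_le_one).1 hint)) ?_
    intro g hg _ hsupp
    have hg0 : ∀ x, x ∉ Ioc (0 : ℝ) 1 → g x = 0 := fun x hx =>
      image_eq_zero_of_notMem_tsupport fun hx' => hx (Ioo_subset_Ioc_self (hsupp hx'))
    have e1 : ∫ x, g x • (H x - (d + x • c)) = ∫ x in (0 : ℝ)..1, g x • (H x - (d + x • c)) := by
      rw [intervalIntegral.integral_of_le zero_le_one,
        setIntegral_eq_integral_of_forall_compl_eq_zero]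
      intro x hx
      rw [hg0 x hx, zero_smul]
    rw [e1]
    set m0 := ∫ x in (0 : ℝ)..1, g x with hm0
    set m1 := ∫ x in (0 : ℝ)..1, x * g x with hm1
    -- The same projection for `g`: then `g - (a + b x)` has vanishing moments and is the second
    -- derivative of a flat test function.
    set a := 4 * m0 - 6 * m1 with ha
    set b := 12 * m1 - 6 * m0 with hb
    have gc := hg.continuous
    have gi : IntervalIntegrable g volume 0 1 := gc.intervalIntegrable 0 1
    have gxi : IntervalIntegrable (fun x => x * g x) volume 0 1 :=
      (continuous_id.mul gc).intervalIntegrable 0 1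
    have w0 : ∫ x in (0 : ℝ)..1, (g x - (a + b * x)) = 0 := by
      rw [intervalIntegral.integral_sub gi (by apply Continuous.intervalIntegrable; fun_prop),
        integral_affine_mul, ← hm0]
      rw [ha, hb]; ring
    have w1 : ∫ x in (0 : ℝ)..1, x * (g x - (a + b * x)) = 0 := by
      simp_rw [mul_sub]
      rw [intervalIntegral.integral_sub gxi (by apply Continuous.intervalIntegrable; fun_prop),
        integral_mul_affine_mul, ← hm1]
      rw [ha, hb]; ring
    obtain ⟨ψ, hψ, z0, z1, z2, z3, hdd⟩ :=
      exists_double_primitive (w := fun x => g x - (a + b * x)) (by fun_prop) w0 w1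
    have hψd : Differentiable ℝ ψ := hψ.differentiable (by simp)
    have hψd' : Differentiable ℝ (deriv ψ) :=
      ((contDiff_infty_iff_deriv.1 hψ).2).differentiable (by simp)
    have hgH : IntervalIntegrable (fun x => (g x - (a + b * x)) • H x) volume 0 1 :=
      hH.continuousOn_smul (Continuous.continuousOn (by fun_prop))
    have e2 : ∫ x in (0 : ℝ)..1, (g x - (a + b * x)) • H x = 0 := by
      refine ext_inner_left ℝ fun v => ?_
      have d1 : deriv (fun x => ψ x • v) = fun x => deriv ψ x • v :=
        funext fun x => ((hψd x).hasDerivAt.smul_const v).deriv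
      have d2 : deriv (fun x => deriv ψ x • v) = fun x => deriv (deriv ψ) x • v :=
        funext fun x => ((hψd' x).hasDerivAt.smul_const v).deriv
      have := h (fun x => ψ x • v)
        ⟨hψ.smul contDiff_const, by simp [z0], by simp [z1], by simp [d1, z2], by simp [d1, z3]⟩
      rw [d1, d2, hdd] at this
      rw [inner_zero_right]
      have e3 := (innerSL ℝ v).intervalIntegral_comp_comm hgH
      simp only [innerSL_apply_apply] at e3
      rw [← e3, ← this]
      congr 1 with x
      rw [inner_smul_right, inner_smul_right, real_inner_comm]
    have gH : IntervalIntegrable (fun x => g x • H x) volume 0 1 :=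
      hH.continuousOn_smul gc.continuousOn
    have e4 : ∫ x in (0 : ℝ)..1, g x • H x = a • H0 + b • H1 := by
      have : ∀ x, (g x - (a + b * x)) • H x = g x • H x - (a • H x + b • (x • H x)) := fun x => by
        module
      simp_rw [this] at e2
      have i1 : IntervalIntegrable (fun x => a • H x) volume 0 1 := hH.smul a
      have i2 : IntervalIntegrable (fun x => b • x • H x) volume 0 1 := hxH.smul b
      rw [intervalIntegral.integral_sub gH (i1.add i2),
        intervalIntegral.integral_add i1 i2, intervalIntegral.integral_smul,
        intervalIntegral.integral_smul, sub_eq_zero] at e2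
      exact e2
    have e5 : ∫ x in (0 : ℝ)..1, g x • (d + x • c) = m0 • d + m1 • c := by
      have : ∀ x, g x • (d + x • c) = g x • d + (x * g x) • c := fun x => by module
      simp_rw [this]
      rw [intervalIntegral.integral_add
        (by apply Continuous.intervalIntegrable; fun_prop)
        (by apply Continuous.intervalIntegrable; fun_prop),
        intervalIntegral.integral_smul_const, intervalIntegral.integral_smul_const]
    -- The inverse Gram matrix is symmetric, so `a • H0 + b • H1 = m0 • d + m1 • c`.
    simp_rw [smul_sub]
    rw [intervalIntegral.integral_sub gH
      (by apply Continuous.intervalIntegrable; fun_prop), e4, e5, ha, hb, hc, hd]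
    module
  filter_upwards [key] with x hx hm
  exact sub_eq_zero.1 (hx hm)

theorem hasACDeriv_deriv_of_contDiff {ψ : ℝ → Plane} (h : ContDiff ℝ ∞ ψ) :
    HasACDeriv (deriv ψ) (deriv (deriv ψ)) := by
  have h1 := (contDiff_infty_iff_deriv.1 h).2
  have h2 := contDiff_infty_iff_deriv.1 h1
  exact HasACDeriv.of_hasDerivAt (fun x => (h2.1 x).hasDerivAt) h2.2.continuous

theorem intervalIntegrable_inner {H g : ℝ → Plane} (hH : IntervalIntegrable H volume 0 1)
    (hg : Continuous g) : IntervalIntegrable (fun x => inner ℝ (H x) (g x)) volume 0 1 := by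
  have hp : ∀ i : Fin 2, IntervalIntegrable (fun x => H x i * g x i) volume 0 1 := fun i =>
    IntervalIntegrable.mul_continuousOn
      ⟨(coordL i).integrable_comp hH.1, (coordL i).integrable_comp hH.2⟩
      ((coordL i).continuous.comp hg).continuousOn
  have := (hp 0).add (hp 1)
  convert this using 2
  simp [inner_eq_coord]

/-- Du Bois-Reymond's lemma of second order. -/
theorem exists_hasACDeriv_of_forall_flatTest {A B : ℝ → Plane}
    (hA : IntervalIntegrable A volume 0 1) (hB : IntervalIntegrable B volume 0 1)
    (h : ∀ ψ, IsFlatTest ψ →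
      ∫ x in (0 : ℝ)..1, (inner ℝ (A x) (deriv ψ x) + inner ℝ (B x) (deriv (deriv ψ) x)) = 0) :
    ∃ (c : Plane) (B' : ℝ → Plane), HasACDeriv B' (fun x => A x + c) ∧
      ∀ᵐ x, x ∈ Ioo (0 : ℝ) 1 → B x = B' x := by
  have hI : HasACDeriv (fun x => ∫ y in (0 : ℝ)..x, A y) A :=
    HasACDeriv.of_integral hA fun x _ => by simp
  have hIi : IntervalIntegrable (fun x => ∫ y in (0 : ℝ)..x, A y) volume 0 1 :=
    hI.continuousOn_uIcc.intervalIntegrable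
  -- Integrating the `A` term by parts moves it onto `ψ''`; the boundary terms vanish with `ψ'`.
  -- Hence `B` minus a primitive of `A` is affine.
  obtain ⟨c, d, hcd⟩ := ae_eq_affine_of_forall_flatTest (hB.sub hIi) (fun ψ hψ => by
    have h1 := contDiff_infty_iff_deriv.1 hψ.smooth
    have c1 : Continuous (deriv ψ) := h1.2.continuous
    have c2 : Continuous (deriv (deriv ψ)) := (contDiff_infty_iff_deriv.1 h1.2).2.continuous
    have e1 := h ψ hψ
    have e2 := hI.integral_inner_eq (hasACDeriv_deriv_of_contDiff hψ.smooth)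
    rw [hψ.deriv_zero, hψ.deriv_one, inner_zero_right, inner_zero_right, sub_zero] at e2
    have i1 := intervalIntegrable_inner hA c1
    have i2 := intervalIntegrable_inner hB c2
    have i3 := intervalIntegrable_inner hIi c2
    rw [intervalIntegral.integral_add i1 i2] at e1
    rw [intervalIntegral.integral_add i3 i1] at e2
    simp_rw [inner_sub_left]
    rw [intervalIntegral.integral_sub i2 i3]
    linarith)
  refine ⟨c, fun x => (∫ y in (0 : ℝ)..x, A y) + (d + x • c), ?_, ?_⟩
  · refine hI.add (HasACDeriv.of_hasDerivAt (f' := fun _ => c) (fun x => ?_) continuous_const)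
    simpa using ((hasDerivAt_id x).smul_const c).const_add d
  · filter_upwards [hcd] with x hx hm
    rw [← hx hm]; abel

/-! ### The energy density, its gradients and their growth -/

/-- The energy density `(k² + δ) |∂ₓγ|` in terms of the velocity `p` and the acceleration `q`. -/
def density (δ : ℝ) (p q : Plane) : ℝ := inner ℝ (rotL p) q ^ 2 / ‖p‖ ^ 5 + δ * ‖p‖

/-- The gradient of the energy density with respect to the velocity. -/
def gradVel (δ : ℝ) (p q : Plane) : Plane :=
  -(2 * inner ℝ (rotL p) q / ‖p‖ ^ 5) • rotL q - (5 * inner ℝ (rotL p) q ^ 2 / ‖p‖ ^ 7) • p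
    + (δ / ‖p‖) • p

/-- The gradient of the energy density with respect to the acceleration. -/
def gradAcc (p q : Plane) : Plane := (2 * inner ℝ (rotL p) q / ‖p‖ ^ 5) • rotL p

theorem hasDerivAt_norm_plane {f : ℝ → Plane} {f' : Plane} {t : ℝ} (hf : HasDerivAt f f' t)
    (h0 : f t ≠ 0) : HasDerivAt (fun s => ‖f s‖) (inner ℝ (f t) f' / ‖f t‖) t := by
  have h1 := hf.norm_sq.sqrt (by simpa using h0)
  have hn := norm_ne_zero_iff.2 h0
  simp only [Real.sqrt_sq (norm_nonneg _)] at h1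
  convert h1 using 1
  field_simp

theorem hasDerivAt_density (δ : ℝ) {p q u w : Plane} {t : ℝ} (h0 : p + t • u ≠ 0) :
    HasDerivAt (fun s : ℝ => density δ (p + s • u) (q + s • w))
      (inner ℝ (gradVel δ (p + t • u) (q + t • w)) u
        + inner ℝ (gradAcc (p + t • u) (q + t • w)) w) t := by
  have hp : HasDerivAt (fun s : ℝ => p + s • u) u t := by
    simpa using ((hasDerivAt_id t).smul_const u).const_add p
  have hq : HasDerivAt (fun s : ℝ => q + s • w) w t := by
    simpa using ((hasDerivAt_id t).smul_const w).const_add q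
  have hn := norm_ne_zero_iff.2 h0
  have hD := hasDerivAt_norm_plane hp h0
  have hJ : HasDerivAt (fun s : ℝ => rotL (p + s • u)) (rotL u) t :=
    rotL.hasFDerivAt.comp_hasDerivAt t hp
  have hN := hJ.inner ℝ hq
  have := ((hN.pow 2).div (hD.pow 5) (pow_ne_zero _ hn)).add (hD.const_mul δ)
  refine this.congr_deriv ?_
  simp only [Pi.pow_apply]
  clear this hN hJ hD hp hq
  generalize p + t • u = P at *
  generalize q + t • w = Q at *
  simp only [gradVel, gradAcc, inner_add_left, inner_sub_left, real_inner_smul_left, inner_neg_left,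
    neg_smul, inner_rotL_left Q, real_inner_comm (rotL u) Q]
  field_simp
  ring

/-- Linear growth in `q` here and quadratic growth for `gradVel` are what an acceleration in `L²`
makes integrable, once the speed is bounded below. -/
theorem norm_gradAcc_le {p : Plane} (hp : p ≠ 0) (q : Plane) :
    ‖gradAcc p q‖ ≤ 2 * ‖q‖ / ‖p‖ ^ 3 := by
  have hn := norm_pos_iff.2 hp
  have hN : |inner ℝ (rotL p) q| ≤ ‖p‖ * ‖q‖ := by
    simpa [norm_rotL] using abs_real_inner_le_norm (rotL p) q
  rw [gradAcc, norm_smul, norm_rotL, Real.norm_eq_abs, abs_div, abs_mul, abs_two,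
    abs_of_pos (pow_pos hn 5), div_mul_eq_mul_div, div_le_div_iff₀ (by positivity) (by positivity)]
  calc 2 * |inner ℝ (rotL p) q| * ‖p‖ * ‖p‖ ^ 3 ≤ 2 * (‖p‖ * ‖q‖) * ‖p‖ * ‖p‖ ^ 3 := by gcongr
    _ = _ := by ring

theorem norm_gradVel_le (δ : ℝ) {p : Plane} (hp : p ≠ 0) (q : Plane) :
    ‖gradVel δ p q‖ ≤ 7 * ‖q‖ ^ 2 / ‖p‖ ^ 4 + |δ| := by
  have hn := norm_pos_iff.2 hp
  have hN : |inner ℝ (rotL p) q| ≤ ‖p‖ * ‖q‖ := by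
    simpa [norm_rotL] using abs_real_inner_le_norm (rotL p) q
  have hN2 : inner ℝ (rotL p) q ^ 2 ≤ (‖p‖ * ‖q‖) ^ 2 := by
    rw [← sq_abs]; gcongr
  have e1 : ‖(2 * inner ℝ (rotL p) q / ‖p‖ ^ 5) • rotL q‖ ≤ 2 * ‖q‖ ^ 2 / ‖p‖ ^ 4 := by
    rw [norm_smul, norm_rotL, Real.norm_eq_abs, abs_div, abs_mul, abs_two,
      abs_of_pos (pow_pos hn 5), div_mul_eq_mul_div, div_le_div_iff₀ (by positivity) (by positivity)]
    calc 2 * |inner ℝ (rotL p) q| * ‖q‖ * ‖p‖ ^ 4 ≤ 2 * (‖p‖ * ‖q‖) * ‖q‖ * ‖p‖ ^ 4 := by gcongr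
      _ = _ := by ring
  have e2 : ‖(5 * inner ℝ (rotL p) q ^ 2 / ‖p‖ ^ 7) • p‖ ≤ 5 * ‖q‖ ^ 2 / ‖p‖ ^ 4 := by
    rw [norm_smul, Real.norm_eq_abs, abs_of_nonneg (by positivity), div_mul_eq_mul_div,
      div_le_div_iff₀ (by positivity) (by positivity)]
    calc 5 * inner ℝ (rotL p) q ^ 2 * ‖p‖ * ‖p‖ ^ 4 ≤ 5 * (‖p‖ * ‖q‖) ^ 2 * ‖p‖ * ‖p‖ ^ 4 := by
          gcongr
      _ = _ := by ring
  have e3 : ‖(δ / ‖p‖) • p‖ = |δ| := by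
    rw [norm_smul, Real.norm_eq_abs, abs_div, abs_norm, div_mul_cancel₀ _ hn.ne']
  have h1 := norm_add_le (-(2 * inner ℝ (rotL p) q / ‖p‖ ^ 5) • rotL q
    - (5 * inner ℝ (rotL p) q ^ 2 / ‖p‖ ^ 7) • p) ((δ / ‖p‖) • p)
  have h2 := norm_sub_le (-(2 * inner ℝ (rotL p) q / ‖p‖ ^ 5) • rotL q)
    ((5 * inner ℝ (rotL p) q ^ 2 / ‖p‖ ^ 7) • p)
  rw [neg_smul, norm_neg, ← neg_smul] at h2
  have e4 : 7 * ‖q‖ ^ 2 / ‖p‖ ^ 4 = 2 * ‖q‖ ^ 2 / ‖p‖ ^ 4 + 5 * ‖q‖ ^ 2 / ‖p‖ ^ 4 := by ring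
  rw [gradVel]
  linarith

theorem bending_le {p : Plane} (hp : p ≠ 0) (q : Plane) :
    inner ℝ (rotL p) q ^ 2 / ‖p‖ ^ 5 ≤ ‖q‖ ^ 2 / ‖p‖ ^ 3 := by
  have hn := norm_pos_iff.2 hp
  have hN : |inner ℝ (rotL p) q| ≤ ‖p‖ * ‖q‖ := by
    simpa [norm_rotL] using abs_real_inner_le_norm (rotL p) q
  rw [div_le_div_iff₀ (by positivity) (by positivity), ← sq_abs]
  calc |inner ℝ (rotL p) q| ^ 2 * ‖p‖ ^ 3 ≤ (‖p‖ * ‖q‖) ^ 2 * ‖p‖ ^ 3 := by gcongr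
    _ = _ := by ring

theorem measurable_gradVel (δ : ℝ) :
    Measurable fun z : Plane × Plane => gradVel δ z.1 z.2 := by
  unfold gradVel
  have : Measurable (rotL : Plane → Plane) := rotL.continuous.measurable
  fun_prop

theorem measurable_gradAcc : Measurable fun z : Plane × Plane => gradAcc z.1 z.2 := by
  unfold gradAcc
  have : Measurable (rotL : Plane → Plane) := rotL.continuous.measurable
  fun_prop

theorem measurable_bending :
    Measurable fun z : Plane × Plane => inner ℝ (rotL z.1) z.2 ^ 2 / ‖z.1‖ ^ 5 := by
  have : Measurable (rotL : Plane → Plane) := rotL.continuous.measurable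
  fun_prop

/-! ### Curves of class H² and the first variation of their energy -/

/-- `γ` is a regular curve of class `H²` with velocity `P` and acceleration `G`. -/
structure IsH2Data (γ P G : ℝ → Plane) : Prop where
  hasDerivWithinAt : ∀ x ∈ Icc (0 : ℝ) 1, HasDerivWithinAt γ (P x) (Icc 0 1) x
  ac : HasACDeriv P G
  memLp : MemLp G 2 (volume.restrict (Icc 0 1))
  ne_zero : ∀ x ∈ Icc (0 : ℝ) 1, P x ≠ 0

theorem uniqueDiffWithinAt_unitInterval {x : ℝ} (hx : x ∈ Icc (0 : ℝ) 1) :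
    UniqueDiffWithinAt ℝ (Icc 0 1) x := uniqueDiffOn_Icc zero_lt_one x hx

theorem dx_eq {V : Type*} [NormedAddCommGroup V] [NormedSpace ℝ V] {f : ℝ → V} {f' : V} {x : ℝ}
    (hx : x ∈ Icc (0 : ℝ) 1) (h : HasDerivWithinAt f f' (Icc 0 1) x) : dx f x = f' :=
  h.derivWithin (uniqueDiffWithinAt_unitInterval hx)

theorem dx_congr {V : Type*} [NormedAddCommGroup V] [NormedSpace ℝ V] {f g : ℝ → V} {x : ℝ}
    (hx : x ∈ Icc (0 : ℝ) 1) (h : EqOn f g (Icc 0 1)) : dx f x = dx g x :=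
  derivWithin_congr h (h hx)

theorem exists_isH2Data {γ : ℝ → Plane} (h : IsH2 γ) (hr : IsRegular γ) :
    ∃ G, IsH2Data γ (dx γ) G := by
  obtain ⟨hd, g, hg, hint⟩ := h
  have hi : IntervalIntegrable g volume 0 1 := by
    rw [intervalIntegrable_iff_integrableOn_Icc_of_le zero_le_one]
    exact hg.integrable one_le_two
  exact ⟨g, fun x hx => (hd x hx).hasDerivWithinAt, HasACDeriv.of_integral hi hint, hg, hr⟩

namespace IsH2Data

variable {γ P G : ℝ → Plane}

theorem dx_eq (h : IsH2Data γ P G) {x : ℝ} (hx : x ∈ Icc (0 : ℝ) 1) : dx γ x = P x :=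
  ElasticNetwork.dx_eq hx (h.hasDerivWithinAt x hx)

theorem tangent_eq (h : IsH2Data γ P G) {x : ℝ} (hx : x ∈ Icc (0 : ℝ) 1) :
    tangent γ x = ‖P x‖⁻¹ • P x := by
  simp only [tangent, ds, h.dx_eq hx]

/-- The tangent is only absolutely continuous. On the exceptional null set `derivWithin` may take
its default value, which the energy integral does not see. -/
theorem curvature_ae (h : IsH2Data γ P G) :
    ∀ᵐ x, x ∈ Ioo (0 : ℝ) 1 → curvature γ x = inner ℝ (rotL (P x)) (G x) / ‖P x‖ ^ 3 := by
  filter_upwards [(h.ac.normalize h.ne_zero).ae_hasDerivAt] with x hx hm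
  have hI : x ∈ Icc (0 : ℝ) 1 := ⟨hm.1.le, hm.2.le⟩
  have h1 : dx (tangent γ) x = (inner ℝ (rotL (P x)) (G x) / ‖P x‖ ^ 3) • rotL (P x) := by
    rw [dx_congr hI fun y hy => h.tangent_eq hy]
    exact ElasticNetwork.dx_eq hI (hx hm).hasDerivWithinAt
  have hn := norm_ne_zero_iff.2 (h.ne_zero x hI)
  rw [curvature, curvatureVector, ds, normal, h1, h.dx_eq hI, h.tangent_eq hI, ← rotL_apply,
    map_smul, real_inner_smul_left, real_inner_smul_left, real_inner_smul_right,
    real_inner_self_eq_norm_sq, norm_rotL]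
  field_simp

theorem length_eq (h : IsH2Data γ P G) : length γ = ∫ x in (0 : ℝ)..1, ‖P x‖ := by
  refine intervalIntegral.integral_congr fun x hx => ?_
  rw [uIcc_of_le zero_le_one] at hx
  simp only [h.dx_eq hx]

theorem elasticEnergy_eq (h : IsH2Data γ P G) :
    elasticEnergy γ = ∫ x in (0 : ℝ)..1, inner ℝ (rotL (P x)) (G x) ^ 2 / ‖P x‖ ^ 5 := by
  refine intervalIntegral.integral_congr_ae ?_
  filter_upwards [h.curvature_ae, ae_ne_zero_one] with x hx hx' hm
  rw [uIoc_of_le zero_le_one] at hm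
  have hI : x ∈ Icc (0 : ℝ) 1 := ⟨hm.1.le, hm.2⟩
  have hn := norm_ne_zero_iff.2 (h.ne_zero x hI)
  rw [hx ⟨hm.1, lt_of_le_of_ne hm.2 hx'.2⟩, h.dx_eq hI]
  field_simp

theorem exists_lower (h : IsH2Data γ P G) : ∃ m > 0, ∀ x ∈ Icc (0 : ℝ) 1, m ≤ ‖P x‖ := by
  obtain ⟨x, hx, hmin⟩ := isCompact_Icc.exists_isMinOn (nonempty_Icc.2 (zero_le_one (α := ℝ)))
    h.ac.continuousOn.norm
  exact ⟨‖P x‖, norm_pos_iff.2 (h.ne_zero x hx), fun y hy => hmin hy⟩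

theorem aemeasurable_pair (h : IsH2Data γ P G) :
    AEMeasurable (fun x => (P x, G x)) (volume.restrict (Icc (0 : ℝ) 1)) :=
  (h.ac.continuousOn.aemeasurable measurableSet_Icc).prodMk h.memLp.1.aemeasurable

theorem integrable_norm_sq (h : IsH2Data γ P G) :
    IntervalIntegrable (fun x => ‖G x‖ ^ 2) volume 0 1 := by
  rw [intervalIntegrable_iff_integrableOn_Icc_of_le zero_le_one]
  exact h.memLp.norm.integrable_sq

theorem intervalIntegrable_of_le {E : Type*} [NormedAddCommGroup E] {f : ℝ → E} {b : ℝ → ℝ}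
    (hf : AEStronglyMeasurable f (volume.restrict (Icc (0 : ℝ) 1)))
    (hb : IntervalIntegrable b volume 0 1) (h : ∀ x ∈ Icc (0 : ℝ) 1, ‖f x‖ ≤ b x) :
    IntervalIntegrable f volume 0 1 := by
  rw [intervalIntegrable_iff_integrableOn_Icc_of_le zero_le_one] at hb ⊢
  refine Integrable.mono' hb hf ?_
  filter_upwards [ae_restrict_mem measurableSet_Icc] with x hx using h x hx

theorem integrable_bending (h : IsH2Data γ P G) :
    IntervalIntegrable (fun x => inner ℝ (rotL (P x)) (G x) ^ 2 / ‖P x‖ ^ 5) volume 0 1 := by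
  obtain ⟨m, hm, hP⟩ := h.exists_lower
  refine intervalIntegrable_of_le
    (measurable_bending.comp_aemeasurable h.aemeasurable_pair).aestronglyMeasurable
    (h.integrable_norm_sq.div_const (m ^ 3)) fun x hx => ?_
  rw [Real.norm_eq_abs, abs_of_nonneg (by positivity)]
  refine (bending_le (h.ne_zero x hx) _).trans ?_
  have := hP x hx
  gcongr

theorem integrable_gradAcc (h : IsH2Data γ P G) :
    IntervalIntegrable (fun x => gradAcc (P x) (G x)) volume 0 1 := by
  obtain ⟨m, hm, hP⟩ := h.exists_lower
  refine intervalIntegrable_of_le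
    (measurable_gradAcc.comp_aemeasurable h.aemeasurable_pair).aestronglyMeasurable
    ((h.ac.integrable.norm.const_mul 2).div_const (m ^ 3)) fun x hx => ?_
  refine (norm_gradAcc_le (h.ne_zero x hx) _).trans ?_
  have := hP x hx
  gcongr

theorem integrable_gradVel (h : IsH2Data γ P G) (δ : ℝ) :
    IntervalIntegrable (fun x => gradVel δ (P x) (G x)) volume 0 1 := by
  obtain ⟨m, hm, hP⟩ := h.exists_lower
  refine intervalIntegrable_of_le
    ((measurable_gradVel δ).comp_aemeasurable h.aemeasurable_pair).aestronglyMeasurable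
    (((h.integrable_norm_sq.const_mul 7).div_const (m ^ 4)).add
      (intervalIntegrable_const (c := |δ|))) fun x hx => ?_
  refine (norm_gradVel_le δ (h.ne_zero x hx) _).trans ?_
  have := hP x hx
  gcongr

theorem energy_eq (h : IsH2Data γ P G) (δ : ℝ) :
    elasticEnergy γ + δ * length γ = ∫ x in (0 : ℝ)..1, density δ (P x) (G x) := by
  have : IntervalIntegrable (fun x => ‖P x‖) volume 0 1 :=
    h.ac.continuousOn_uIcc.norm.intervalIntegrable
  rw [h.elasticEnergy_eq, h.length_eq, ← intervalIntegral.integral_const_mul,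
    ← intervalIntegral.integral_add h.integrable_bending (this.const_mul δ)]
  rfl

theorem add_smul (h : IsH2Data γ P G) {ψ : ℝ → Plane} (hψ : ContDiff ℝ ∞ ψ) {t : ℝ}
    (h0 : ∀ x ∈ Icc (0 : ℝ) 1, P x + t • deriv ψ x ≠ 0) :
    IsH2Data (fun x => γ x + t • ψ x) (fun x => P x + t • deriv ψ x)
      (fun x => G x + t • deriv (deriv ψ) x) := by
  have h1 := contDiff_infty_iff_deriv.1 hψ
  have h2 := contDiff_infty_iff_deriv.1 h1.2
  refine ⟨fun x hx => ?_, ?_, ?_, h0⟩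
  · exact (h.hasDerivWithinAt x hx).add ((h1.1 x).hasDerivAt.const_smul t).hasDerivWithinAt
  · exact h.ac.add ((hasACDeriv_deriv_of_contDiff hψ).clm_comp
      (t • ContinuousLinearMap.id ℝ Plane))
  · refine h.memLp.add (MemLp.const_smul ?_ t)
    obtain ⟨C, hC⟩ := isCompact_Icc.exists_bound_of_continuousOn
      (h2.2.continuous.continuousOn (s := Icc (0 : ℝ) 1))
    refine MemLp.of_bound h2.2.continuous.aestronglyMeasurable C ?_
    filter_upwards [ae_restrict_mem measurableSet_Icc] with x hx using hC x hx

/-- The first variation of the energy of a curve. -/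
theorem hasDerivAt_energy (h : IsH2Data γ P G) (δ : ℝ) {ψ : ℝ → Plane} (hψ : ContDiff ℝ ∞ ψ) :
    HasDerivAt (fun t : ℝ => elasticEnergy (fun x => γ x + t • ψ x)
        + δ * length (fun x => γ x + t • ψ x))
      (∫ x in (0 : ℝ)..1, (inner ℝ (gradVel δ (P x) (G x)) (deriv ψ x)
        + inner ℝ (gradAcc (P x) (G x)) (deriv (deriv ψ) x))) 0 := by
  have h1 := contDiff_infty_iff_deriv.1 hψ
  have h2 := contDiff_infty_iff_deriv.1 h1.2
  obtain ⟨m, hm, hP⟩ := h.exists_lower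
  obtain ⟨C1, hC1⟩ := isCompact_Icc.exists_bound_of_continuousOn
      (h1.2.continuous.continuousOn (s := Icc (0 : ℝ) 1))
  obtain ⟨C2, hC2⟩ := isCompact_Icc.exists_bound_of_continuousOn
      (h2.2.continuous.continuousOn (s := Icc (0 : ℝ) 1))
  obtain ⟨M, hM, hM1, hM2⟩ : ∃ M > 0, C1 ≤ M ∧ C2 ≤ M :=
    ⟨max 1 (max C1 C2), by positivity, by simp, by simp⟩
  -- `m / (2 * M)` keeps the perturbed speed above `m / 2`; `1` keeps the perturbed acceleration
  -- below `‖G x‖ + M`.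
  set ε := min 1 (m / (2 * M)) with hε
  have hε0 : 0 < ε := by positivity
  have hlow : ∀ t ∈ Metric.ball (0 : ℝ) ε, ∀ x ∈ Icc (0 : ℝ) 1,
      m / 2 ≤ ‖P x + t • deriv ψ x‖ := by
    intro t ht x hx
    rw [Metric.mem_ball, dist_zero_right, Real.norm_eq_abs] at ht
    have e1 : ‖t • deriv ψ x‖ ≤ m / (2 * M) * M := by
      rw [norm_smul, Real.norm_eq_abs]
      have := (hC1 x hx).trans hM1
      have := ht.le.trans (min_le_right _ _)
      gcongr
    have e2 : m / (2 * M) * M = m / 2 := by field_simp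
    have e3 := norm_sub_norm_le (P x) (-(t • deriv ψ x))
    rw [norm_neg, sub_neg_eq_add] at e3
    have := hP x hx
    linarith
  have hne : ∀ t ∈ Metric.ball (0 : ℝ) ε, ∀ x ∈ Icc (0 : ℝ) 1, P x + t • deriv ψ x ≠ 0 :=
    fun t ht x hx => norm_pos_iff.1 ((half_pos hm).trans_le (hlow t ht x hx))
  have hdata : ∀ t ∈ Metric.ball (0 : ℝ) ε, _ := fun t ht => h.add_smul hψ (hne t ht)
  have hup : ∀ t ∈ Metric.ball (0 : ℝ) ε, ∀ x ∈ Icc (0 : ℝ) 1,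
      ‖G x + t • deriv (deriv ψ) x‖ ≤ ‖G x‖ + M := by
    intro t ht x hx
    rw [Metric.mem_ball, dist_zero_right, Real.norm_eq_abs] at ht
    refine (norm_add_le _ _).trans (add_le_add_right ?_ _)
    rw [norm_smul, Real.norm_eq_abs]
    have e1 := (hC2 x hx).trans hM2
    have e2 := ht.le.trans (min_le_left _ _)
    calc |t| * ‖deriv (deriv ψ) x‖ ≤ 1 * M := by gcongr
      _ = M := one_mul M
  have hball : Metric.ball (0 : ℝ) ε ∈ 𝓝 (0 : ℝ) := Metric.ball_mem_nhds _ hε0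
  have hsub : uIoc (0 : ℝ) 1 ⊆ Icc 0 1 := by
    rw [uIoc_of_le zero_le_one]; exact Ioc_subset_Icc_self
  -- The dominating function is quadratic in `‖G x‖`, hence integrable.
  have key := intervalIntegral.hasDerivAt_integral_of_dominated_loc_of_deriv_le
    (μ := volume) (a := 0) (b := 1) (x₀ := (0 : ℝ))
    (F := fun t x => density δ (P x + t • deriv ψ x) (G x + t • deriv (deriv ψ) x))
    (F' := fun t x => inner ℝ (gradVel δ (P x + t • deriv ψ x) (G x + t • deriv (deriv ψ) x))
        (deriv ψ x) + inner ℝ (gradAcc (P x + t • deriv ψ x) (G x + t • deriv (deriv ψ) x))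
        (deriv (deriv ψ) x))
    (bound := fun x => (7 * (‖G x‖ + M) ^ 2 / (m / 2) ^ 4 + |δ|) * M
      + 2 * (‖G x‖ + M) / (m / 2) ^ 3 * M) hball ?_ ?_ ?_ ?_ ?_ ?_
  · simp only [zero_smul, add_zero] at key
    refine key.2.congr_of_eventuallyEq ?_
    filter_upwards [hball] with t ht
    exact (hdata t ht).energy_eq δ
  · filter_upwards [hball] with t ht
    have hd := hdata t ht
    refine AEStronglyMeasurable.add ?_ ?_
    · exact (measurable_bending.comp_aemeasurable
        hd.aemeasurable_pair).aestronglyMeasurable.mono_set hsub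
    · exact ((hd.ac.continuousOn.norm.aestronglyMeasurable measurableSet_Icc).const_mul
        δ).mono_set hsub
  · have hd := hdata 0 (Metric.mem_ball_self hε0)
    exact hd.integrable_bending.add (hd.ac.continuousOn_uIcc.norm.intervalIntegrable.const_mul δ)
  · have hd := hdata 0 (Metric.mem_ball_self hε0)
    exact ((intervalIntegrable_inner (hd.integrable_gradVel δ) h1.2.continuous).add
      (intervalIntegrable_inner hd.integrable_gradAcc h2.2.continuous)).def'.1
  · refine ae_of_all _ fun x hx t ht => ?_
    have hx' := hsub hx
    have e1 := norm_gradVel_le δ (hne t ht x hx') (G x + t • deriv (deriv ψ) x)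
    have e2 := norm_gradAcc_le (hne t ht x hx') (G x + t • deriv (deriv ψ) x)
    have u1 := hup t ht x hx'
    have l1 := hlow t ht x hx'
    have b1 := (hC1 x hx').trans hM1
    have b2 := (hC2 x hx').trans hM2
    have e1' : ‖gradVel δ (P x + t • deriv ψ x) (G x + t • deriv (deriv ψ) x)‖
        ≤ 7 * (‖G x‖ + M) ^ 2 / (m / 2) ^ 4 + |δ| := e1.trans (by gcongr)
    have e2' : ‖gradAcc (P x + t • deriv ψ x) (G x + t • deriv (deriv ψ) x)‖
        ≤ 2 * (‖G x‖ + M) / (m / 2) ^ 3 := e2.trans (by gcongr)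
    refine (norm_add_le _ _).trans (add_le_add ?_ ?_)
    · exact (norm_inner_le_norm _ _).trans (by gcongr)
    · exact (norm_inner_le_norm _ _).trans (by gcongr)
  · have i1 : IntervalIntegrable (fun x => ‖G x‖) volume 0 1 := h.ac.integrable.norm
    have i2 : IntervalIntegrable (fun x => ‖G x‖ + M) volume 0 1 :=
      i1.add intervalIntegrable_const
    have i3 : IntervalIntegrable (fun x => (‖G x‖ + M) ^ 2) volume 0 1 := by
      have := (h.integrable_norm_sq.add (i1.const_mul (2 * M))).add
        (intervalIntegrable_const (c := M ^ 2))
      refine this.congr fun x _ => ?_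
      ring
    exact ((((i3.const_mul 7).div_const _).add intervalIntegrable_const).mul_const M).add
      (((i2.const_mul 2).div_const _).mul_const M)
  · exact ae_of_all _ fun x hx t ht => hasDerivAt_density δ (hne t ht x (hsub hx))

end IsH2Data

/-! ### From stationarity to the elastica equations -/

/-- Extending `f'` by constants beyond `[0,1]` gives a continuous integrand on the line, so the
fundamental theorem applies at the end points too. -/
theorem HasACDeriv.hasDerivWithinAt {f f' : ℝ → Plane} (h : HasACDeriv f f')
    (hc : ContinuousOn f' (Icc 0 1)) {x : ℝ} (hx : x ∈ Icc (0 : ℝ) 1) :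
    HasDerivWithinAt f (f' x) (Icc 0 1) x := by
  set g : ℝ → Plane := IccExtend (zero_le_one (α := ℝ)) ((Icc 0 1).domRestrict f') with hg
  have hgc : Continuous g := continuous_IccExtend_iff.2 hc.domRestrict
  have hgf : ∀ y ∈ Icc (0 : ℝ) 1, g y = f' y := fun y hy => by
    rw [hg, IccExtend_of_mem _ _ hy]; rfl
  have h1 : ∀ y ∈ Icc (0 : ℝ) 1, f y = f 0 + ∫ z in (0 : ℝ)..y, g z := fun y hy => by
    rw [h.eq_integral hy]
    congr 1
    refine intervalIntegral.integral_congr fun z hz => ?_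
    rw [uIcc_of_le hy.1] at hz
    exact (hgf z ⟨hz.1, hz.2.trans hy.2⟩).symm
  rw [← hgf x hx]
  exact (((hgc.integral_hasStrictDerivAt 0 x).hasDerivAt.const_add (f 0)).hasDerivWithinAt).congr
    h1 (h1 x hx)

theorem eqOn_of_ae_eq {E : Type*} [TopologicalSpace E] [T2Space E] {f g : ℝ → E}
    (h : ∀ᵐ x, x ∈ Ioo (0 : ℝ) 1 → f x = g x) (hf : ContinuousOn f (Icc 0 1))
    (hg : ContinuousOn g (Icc 0 1)) : EqOn f g (Icc 0 1) := by
  refine Measure.eqOn_Icc_of_ae_eq volume zero_ne_one ?_ hf hg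
  rw [EventuallyEq, ae_restrict_iff' measurableSet_Icc]
  filter_upwards [h, ae_ne_zero_one] with x hx hx' hm
  exact hx ⟨lt_of_le_of_ne hm.1 hx'.1.symm, lt_of_le_of_ne hm.2 hx'.2⟩

/-- The left side occurs in the derivative of the speed times `gradAcc`. On the right the
acceleration enters only through the curvature, so a continuous curvature makes that derivative
continuous. -/
theorem gradVel_identity (δ : ℝ) {p q : Plane} (hp : p ≠ 0) :
    ‖p‖ • gradVel δ p q + (inner ℝ p q / ‖p‖) • gradAcc p q =
      (δ - 3 * (inner ℝ (rotL p) q / ‖p‖ ^ 3) ^ 2) • p := by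
  have hn := norm_ne_zero_iff.2 hp
  have h2 : rotL q = (‖p‖ ^ 2)⁻¹ • (-inner ℝ (rotL p) q • p + inner ℝ p q • rotL p) := by
    have := norm_sq_smul_eq p (rotL q)
    rw [inner_rotL_rotL, ← neg_eq_iff_eq_neg.2 (inner_rotL_left p q)] at this
    rw [← this, smul_smul, inv_mul_cancel₀ (by positivity), one_smul]
  rw [gradVel, gradAcc, h2]
  simp only [smul_add, smul_sub, smul_smul]
  match_scalars
  · field_simp
    ring
  · field_simp
    ring

/-- The elastica equations for the unit tangent `T`, the curvature `K` and the speed `θ`, in a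
general parametrization. The constant vector `c` is the conserved force. -/
structure IsElastica (δ : ℝ) (c : Plane) (θ K : ℝ → ℝ) (T : ℝ → Plane) : Prop where
  norm_eq_one : ∀ x ∈ Icc (0 : ℝ) 1, ‖T x‖ = 1
  deriv_tangent : ∀ x ∈ Icc (0 : ℝ) 1, HasDerivWithinAt T ((θ x * K x) • rotL (T x)) (Icc 0 1) x
  deriv_curvature : ∀ x ∈ Icc (0 : ℝ) 1,
    HasDerivWithinAt K (θ x * (inner ℝ c (rotL (T x)) / 2)) (Icc 0 1) x
  force_tangent : ∀ x ∈ Icc (0 : ℝ) 1, inner ℝ c (T x) = K x ^ 2 - δ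

/-- The first variation of the energy in the direction `ψ`. -/
def firstVariation (δ : ℝ) (P G ψ : ℝ → Plane) : ℝ :=
  ∫ x in (0 : ℝ)..1, (inner ℝ (gradVel δ (P x) (G x)) (deriv ψ x)
    + inner ℝ (gradAcc (P x) (G x)) (deriv (deriv ψ) x))

/-- A stationary curve of class `H²` solves the elastica equations, and its first variation reduces
to boundary terms. -/
theorem IsH2Data.exists_isElastica {γ P G : ℝ → Plane} (h : IsH2Data γ P G) {δ : ℝ}
    (hstat : ∀ ψ, IsFlatTest ψ → firstVariation δ P G ψ = 0) :
    ∃ (c : Plane) (K : ℝ → ℝ),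
      IsElastica δ c (fun x => ‖P x‖) K (fun x => ‖P x‖⁻¹ • P x) ∧
      ∀ ψ, ContDiff ℝ ∞ ψ → firstVariation δ P G ψ =
        inner ℝ ((2 * K 1 / ‖P 1‖ ^ 2) • rotL (P 1)) (deriv ψ 1)
        - inner ℝ ((2 * K 0 / ‖P 0‖ ^ 2) • rotL (P 0)) (deriv ψ 0) - inner ℝ c (ψ 1 - ψ 0) := by
  obtain ⟨c, B, hB, hBae⟩ := exists_hasACDeriv_of_forall_flatTest (h.integrable_gradVel δ)
    h.integrable_gradAcc hstat
  have hT := h.ac.normalize h.ne_zero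
  set T : ℝ → Plane := fun x => ‖P x‖⁻¹ • P x with hTdef
  have hn : ∀ x ∈ Icc (0 : ℝ) 1, ‖P x‖ ≠ 0 := fun x hx => norm_ne_zero_iff.2 (h.ne_zero x hx)
  have hT1 : ∀ x ∈ Icc (0 : ℝ) 1, ‖T x‖ = 1 := fun x hx => by
    rw [hTdef, norm_smul, norm_inv, norm_norm, inv_mul_cancel₀ (hn x hx)]
  have hPT : ∀ x ∈ Icc (0 : ℝ) 1, P x = ‖P x‖ • T x := fun x hx => by
    rw [hTdef, smul_smul, mul_inv_cancel₀ (hn x hx), one_smul]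
  have hθ := h.ac.norm_plane h.ne_zero
  have hW := hθ.smul hB
  -- `W` is the continuous version of `2kν`. Reading `K` off `W` instead of `G` makes `K`
  -- continuous, after which `T` and `W` are `C¹`.
  set W : ℝ → Plane := fun x => ‖P x‖ • B x with hWdef
  set K : ℝ → ℝ := fun x => inner ℝ (W x) (rotL (T x)) / 2 with hK
  have hJT : ContinuousOn (fun x => rotL (T x)) (Icc 0 1) :=
    rotL.continuous.comp_continuousOn hT.continuousOn
  have hKc : ContinuousOn K (Icc 0 1) := (hW.continuousOn.inner hJT).div_const 2
  have hWae : ∀ᵐ x, x ∈ Ioo (0 : ℝ) 1 →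
      W x = (2 * (inner ℝ (rotL (P x)) (G x) / ‖P x‖ ^ 3)) • rotL (T x) := by
    filter_upwards [hBae] with x hx hm
    have hx0 := hn x (Ioo_subset_Icc_self hm)
    simp only [hWdef, hTdef]
    rw [← hx hm, gradAcc, map_smul, smul_smul, smul_smul]
    congr 1
    field_simp
  have hKae : ∀ᵐ x, x ∈ Ioo (0 : ℝ) 1 → inner ℝ (rotL (P x)) (G x) / ‖P x‖ ^ 3 = K x := by
    filter_upwards [hWae] with x hx hm
    have hx1 := hT1 x (Ioo_subset_Icc_self hm)
    simp only [hK]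
    rw [hx hm, real_inner_smul_left, real_inner_self_eq_norm_sq, norm_rotL, hx1]
    ring
  have hWK : EqOn W (fun x => (2 * K x) • rotL (T x)) (Icc 0 1) := by
    refine eqOn_of_ae_eq ?_ hW.continuousOn ((hKc.const_smul (2 : ℝ)).smul hJT)
    filter_upwards [hWae, hKae] with x h1 h2 hm
    rw [h1 hm, h2 hm]
  have hT' : HasACDeriv T (fun x => (‖P x‖ * K x) • rotL (T x)) := by
    refine hT.congr_deriv ?_
    filter_upwards [hKae] with x hx hm
    rw [hx hm]
    conv_lhs => rw [hPT x (Ioo_subset_Icc_self hm)]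
    rw [map_smul, smul_smul, mul_comm]
  have hTd : ∀ x ∈ Icc (0 : ℝ) 1,
      HasDerivWithinAt T ((‖P x‖ * K x) • rotL (T x)) (Icc 0 1) x := fun x hx =>
    hT'.hasDerivWithinAt ((h.ac.continuousOn.norm.mul hKc).smul hJT) hx
  have hW' : HasACDeriv W (fun x => ‖P x‖ • ((δ - 3 * K x ^ 2) • T x + c)) := by
    refine hW.congr_deriv ?_
    filter_upwards [hKae, hBae] with x h1 h2 hm
    have hx := Ioo_subset_Icc_self hm
    have := gradVel_identity δ (q := G x) (h.ne_zero x hx)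
    rw [h1 hm, h2 hm] at this
    rw [smul_add, add_right_comm, this, smul_add, smul_comm, ← hPT x hx]
  have hWd : ∀ x ∈ Icc (0 : ℝ) 1,
      HasDerivWithinAt W (‖P x‖ • ((δ - 3 * K x ^ 2) • T x + c)) (Icc 0 1) x := fun x hx =>
    hW'.hasDerivWithinAt (h.ac.continuousOn.norm.smul
      (((continuousOn_const.sub (continuousOn_const.mul (hKc.pow 2))).smul hT.continuousOn).add
        continuousOn_const)) hx
  refine ⟨c, K, ⟨hT1, hTd, fun x hx => ?_, fun x hx => ?_⟩, fun ψ hψ => ?_⟩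
  · have hJd : HasDerivWithinAt (fun x => rotL (T x)) (rotL ((‖P x‖ * K x) • rotL (T x)))
        (Icc 0 1) x := rotL.hasFDerivAt.comp_hasDerivWithinAt x (hTd x hx)
    refine (((hWd x hx).inner ℝ hJd).div_const 2).congr_deriv ?_
    rw [hWK hx, map_smul, rotL_rotL]
    simp only [real_inner_smul_left, real_inner_smul_right, inner_add_left, inner_neg_right,
      inner_self_rotL, inner_rotL_self]
    ring
  -- `W` is normal; the derivative of `⟪W, T⟫ = 0` is the tangential part of the equation for `W`.
  · have hz : EqOn (fun x => inner ℝ (W x) (T x)) (fun _ => (0 : ℝ)) (Icc 0 1) := fun y hy => by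
      simp only [hWK hy, real_inner_smul_left, inner_rotL_self, mul_zero]
    have h1 := ((hWd x hx).inner ℝ (hTd x hx)).congr (f₁ := fun _ => (0 : ℝ))
      (fun y hy => (hz hy).symm) (hz hx).symm
    have h2 := (uniqueDiffWithinAt_unitInterval hx).eq_deriv _ h1 (hasDerivWithinAt_const _ _ _)
    rw [hWK hx] at h2
    simp only [real_inner_smul_left, real_inner_smul_right, inner_add_left,
      real_inner_self_eq_norm_sq, norm_rotL, hT1 x hx] at h2
    have h3 : ‖P x‖ * (inner ℝ c (T x) - (K x ^ 2 - δ)) = 0 := by linear_combination h2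
    exact sub_eq_zero.1 ((mul_eq_zero.1 h3).resolve_left (hn x hx))
  · have h1 := contDiff_infty_iff_deriv.1 hψ
    have c1 : Continuous (deriv ψ) := h1.2.continuous
    have c2 : Continuous (deriv (deriv ψ)) := (contDiff_infty_iff_deriv.1 h1.2).2.continuous
    have hψd : HasACDeriv ψ (deriv ψ) :=
      HasACDeriv.of_hasDerivAt (fun x => (h1.1 x).hasDerivAt) c1
    have e2 := hB.integral_inner_eq (hasACDeriv_deriv_of_contDiff hψ)
    have e3 := (hψd.clm_comp (innerSL ℝ c)).eq_integral_real (x := 1) (by simp)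
    have i1 := intervalIntegrable_inner (h.integrable_gradVel δ) c1
    have i2 := intervalIntegrable_inner h.integrable_gradAcc c2
    have i3 : IntervalIntegrable (fun x => inner ℝ c (deriv ψ x)) volume 0 1 :=
      (Continuous.inner continuous_const c1).intervalIntegrable 0 1
    -- Adding and subtracting `c` completes the derivative of `⟪B, ψ'⟫`, which leaves boundary terms
    -- only.
    have e4 : firstVariation δ P G ψ = ∫ x in (0 : ℝ)..1, ((inner ℝ (B x) (deriv (deriv ψ) x)
        + inner ℝ (gradVel δ (P x) (G x) + c) (deriv ψ x)) - inner ℝ c (deriv ψ x)) := by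
      refine intervalIntegral.integral_congr_ae ?_
      filter_upwards [hBae, ae_ne_zero_one] with x hx hx' hm
      rw [uIoc_of_le zero_le_one] at hm
      rw [hx ⟨hm.1, lt_of_le_of_ne hm.2 hx'.2⟩, inner_add_left]
      ring
    have i4 : IntervalIntegrable (fun x => inner ℝ (B x) (deriv (deriv ψ) x)
        + inner ℝ (gradVel δ (P x) (G x) + c) (deriv ψ x)) volume 0 1 :=
      (intervalIntegrable_inner hB.continuousOn_uIcc.intervalIntegrable c2).add
        (intervalIntegrable_inner hB.integrable c1)
    rw [intervalIntegral.integral_sub i4 i3, e2] at e4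
    have hBK : ∀ x ∈ Icc (0 : ℝ) 1, B x = (2 * K x / ‖P x‖ ^ 2) • rotL (P x) := fun x hx => by
      have e5 : ‖P x‖ • B x = _ := hWK hx
      have hx0 := hn x hx
      have e6 : B x = ‖P x‖⁻¹ • ‖P x‖ • B x := by
        rw [smul_smul, inv_mul_cancel₀ hx0, one_smul]
      rw [e6, e5]
      simp only [hTdef, map_smul, smul_smul]
      congr 1
      field_simp
    rw [← hBK 0 (by simp), ← hBK 1 (by simp), e4, inner_sub_right]
    simp only [innerSL_apply_apply] at e3
    rw [e3]
    ring

/-! ### Smoothness and the Euler–Lagrange equations at constant speed -/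

/-- Solutions of an autonomous differential equation with smooth right-hand side are smooth. -/
theorem contDiffOn_of_autonomous {E : Type*} [NormedAddCommGroup E] [NormedSpace ℝ E]
    {F : E → E} (hF : ContDiff ℝ ∞ F) {z : ℝ → E}
    (hz : ∀ x ∈ Icc (0 : ℝ) 1, HasDerivWithinAt z (F (z x)) (Icc 0 1) x) :
    ContDiffOn ℝ ∞ z (Icc 0 1) := by
  have hu : UniqueDiffOn ℝ (Icc (0 : ℝ) 1) := uniqueDiffOn_Icc zero_lt_one
  rw [contDiffOn_infty]
  intro n
  -- Bootstrapping: if `z` is `Cⁿ`, then so is `z' = F ∘ z`.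
  induction n with
  | zero =>
    exact contDiffOn_zero.2 fun x hx => (hz x hx).continuousWithinAt
  | succ n ih =>
    push_cast
    rw [contDiffOn_succ_iff_derivWithin hu]
    refine ⟨fun x hx => (hz x hx).differentiableWithinAt, fun h => by simp at h, ?_⟩
    refine ContDiffOn.congr (f := fun x => F (z x)) ?_ fun x hx => (hz x hx).derivWithin (hu x hx)
    exact (hF.of_le (by exact_mod_cast le_top)).comp_contDiffOn ih

namespace IsElastica

variable {δ L : ℝ} {c : Plane} {K : ℝ → ℝ} {T σ : ℝ → Plane}

/-- With constant speed, `(K, T)` solves an autonomous system whose right-hand side is polynomial.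
-/
theorem contDiffOn (h : IsElastica δ c (fun _ => L) K T) : ContDiffOn ℝ ∞ T (Icc 0 1) := by
  have hF : ContDiff ℝ ∞ (fun z : ℝ × Plane =>
      ((L * (inner ℝ c (rotL z.2) / 2), (L * z.1) • rotL z.2) : ℝ × Plane)) := by
    have : ContDiff ℝ ∞ (rotL : Plane → Plane) := rotL.contDiff
    have h2 : ContDiff ℝ ∞ (fun z : ℝ × Plane => inner ℝ c (rotL z.2)) :=
      contDiff_const.inner ℝ (this.comp contDiff_snd)
    fun_prop
  exact (contDiffOn_of_autonomous hF (z := fun x => (K x, T x))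
    fun x hx => (h.deriv_curvature x hx).prodMk (h.deriv_tangent x hx)).snd

theorem dx_curve (h : IsElastica δ c (fun _ => L) K T) (hL : 0 < L)
    (hσ : ∀ x ∈ Icc (0 : ℝ) 1, HasDerivWithinAt σ (L • T x) (Icc 0 1) x) {x : ℝ}
    (hx : x ∈ Icc (0 : ℝ) 1) : dx σ x = L • T x ∧ ‖dx σ x‖ = L := by
  rw [dx_eq hx (hσ x hx), norm_smul, h.norm_eq_one x hx, Real.norm_of_nonneg hL.le, mul_one]
  exact ⟨rfl, rfl⟩

variable {V : Type*} [NormedAddCommGroup V] [NormedSpace ℝ V]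

theorem ds_eq (h : IsElastica δ c (fun _ => L) K T) (hL : 0 < L)
    (hσ : ∀ x ∈ Icc (0 : ℝ) 1, HasDerivWithinAt σ (L • T x) (Icc 0 1) x) {f g : ℝ → V} {f' : V}
    {x : ℝ} (hx : x ∈ Icc (0 : ℝ) 1) (hfg : EqOn f g (Icc 0 1))
    (hg : HasDerivWithinAt g (L • f') (Icc 0 1) x) : ds σ f x = f' := by
  rw [ds, (h.dx_curve hL hσ hx).2, dx_congr hx hfg, dx_eq hx hg, smul_smul,
    inv_mul_cancel₀ hL.ne', one_smul]

theorem tangent_eq (h : IsElastica δ c (fun _ => L) K T) (hL : 0 < L)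
    (hσ : ∀ x ∈ Icc (0 : ℝ) 1, HasDerivWithinAt σ (L • T x) (Icc 0 1) x) :
    EqOn (tangent σ) T (Icc 0 1) := fun x hx =>
  h.ds_eq hL hσ hx (fun _ _ => rfl) (hσ x hx)

theorem curvatureVector_eq (h : IsElastica δ c (fun _ => L) K T) (hL : 0 < L)
    (hσ : ∀ x ∈ Icc (0 : ℝ) 1, HasDerivWithinAt σ (L • T x) (Icc 0 1) x) :
    EqOn (curvatureVector σ) (fun x => K x • rotL (T x)) (Icc 0 1) := fun x hx => by
  refine h.ds_eq hL hσ hx (h.tangent_eq hL hσ) ?_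
  rw [smul_smul]
  exact h.deriv_tangent x hx

theorem normal_eq (h : IsElastica δ c (fun _ => L) K T) (hL : 0 < L)
    (hσ : ∀ x ∈ Icc (0 : ℝ) 1, HasDerivWithinAt σ (L • T x) (Icc 0 1) x) :
    EqOn (normal σ) (fun x => rotL (T x)) (Icc 0 1) := fun x hx => by
  simp only [normal, h.tangent_eq hL hσ hx, rotL_apply]

theorem curvature_eq (h : IsElastica δ c (fun _ => L) K T) (hL : 0 < L)
    (hσ : ∀ x ∈ Icc (0 : ℝ) 1, HasDerivWithinAt σ (L • T x) (Icc 0 1) x) :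
    EqOn (curvature σ) K (Icc 0 1) := fun x hx => by
  rw [curvature, h.curvatureVector_eq hL hσ hx, h.normal_eq hL hσ hx]
  simp only [real_inner_smul_left, real_inner_self_eq_norm_sq, norm_rotL, h.norm_eq_one x hx]
  ring

theorem ds_curvature_eq (h : IsElastica δ c (fun _ => L) K T) (hL : 0 < L)
    (hσ : ∀ x ∈ Icc (0 : ℝ) 1, HasDerivWithinAt σ (L • T x) (Icc 0 1) x) :
    EqOn (ds σ (curvature σ)) (fun x => inner ℝ c (rotL (T x)) / 2) (Icc 0 1) := fun x hx =>
  h.ds_eq hL hσ hx (h.curvature_eq hL hσ) (h.deriv_curvature x hx)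

theorem deriv_normal (h : IsElastica δ c (fun _ => L) K T) {x : ℝ} (hx : x ∈ Icc (0 : ℝ) 1) :
    HasDerivWithinAt (fun x => rotL (T x)) (-((L * K x) • T x)) (Icc 0 1) x := by
  refine (rotL.hasFDerivAt.comp_hasDerivWithinAt x (h.deriv_tangent x hx)).congr_deriv ?_
  rw [map_smul, rotL_rotL, smul_neg]

/-- The second arclength derivative of the curvature. -/
theorem deriv_ds_curvature (h : IsElastica δ c (fun _ => L) K T) {x : ℝ}
    (hx : x ∈ Icc (0 : ℝ) 1) :
    HasDerivWithinAt (fun x => inner ℝ c (rotL (T x)) / 2)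
      (L • (-(K x * (K x ^ 2 - δ)) / 2)) (Icc 0 1) x := by
  refine (((hasDerivWithinAt_const x (Icc 0 1) c).inner ℝ (h.deriv_normal hx)).div_const
    2).congr_deriv ?_
  rw [inner_neg_right, real_inner_smul_right, h.force_tangent x hx, inner_zero_left, smul_eq_mul]
  ring

theorem ds_ds_curvature_eq (h : IsElastica δ c (fun _ => L) K T) (hL : 0 < L)
    (hσ : ∀ x ∈ Icc (0 : ℝ) 1, HasDerivWithinAt σ (L • T x) (Icc 0 1) x) {x : ℝ}
    (hx : x ∈ Icc (0 : ℝ) 1) :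
    ds σ (ds σ (curvature σ)) x = -(K x * (K x ^ 2 - δ)) / 2 :=
  h.ds_eq hL hσ hx (h.ds_curvature_eq hL hσ) (h.deriv_ds_curvature hx)

theorem scalarEulerLagrange (h : IsElastica δ c (fun _ => L) K T) (hL : 0 < L)
    (hσ : ∀ x ∈ Icc (0 : ℝ) 1, HasDerivWithinAt σ (L • T x) (Icc 0 1) x) :
    ScalarEulerLagrange δ σ := fun x hx => by
  have hx' := Ioo_subset_Icc_self hx
  rw [h.ds_ds_curvature_eq hL hσ hx', h.curvature_eq hL hσ hx']
  ring

/-- The normal derivative of a normal field. -/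
theorem dsPerp_eq (h : IsElastica δ c (fun _ => L) K T) (hL : 0 < L)
    (hσ : ∀ x ∈ Icc (0 : ℝ) 1, HasDerivWithinAt σ (L • T x) (Icc 0 1) x) {f : ℝ → Plane}
    {r : ℝ → ℝ} {r' x : ℝ} (hx : x ∈ Icc (0 : ℝ) 1)
    (hf : EqOn f (fun x => r x • rotL (T x)) (Icc 0 1))
    (hr : HasDerivWithinAt r (L • r') (Icc 0 1) x) : dsPerp σ f x = r' • rotL (T x) := by
  have h1 : ds σ f x = r' • rotL (T x) - (r x * K x) • T x := by
    refine h.ds_eq hL hσ hx hf ((hr.smul (h.deriv_normal hx)).congr_deriv ?_)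
    simp only [smul_eq_mul]
    module
  have h2 : ds σ σ x = T x := h.tangent_eq hL hσ hx
  rw [dsPerp, h1, h2, inner_sub_left, real_inner_smul_left, real_inner_smul_left, inner_rotL_self,
    real_inner_self_eq_norm_sq, h.norm_eq_one x hx]
  module

theorem vectorEulerLagrange (h : IsElastica δ c (fun _ => L) K T) (hL : 0 < L)
    (hσ : ∀ x ∈ Icc (0 : ℝ) 1, HasDerivWithinAt σ (L • T x) (Icc 0 1) x) :
    VectorEulerLagrange δ σ := fun x hx => by
  have hx' := Ioo_subset_Icc_self hx
  have h1 : EqOn (dsPerp σ (curvatureVector σ))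
      (fun x => (inner ℝ c (rotL (T x)) / 2) • rotL (T x)) (Icc 0 1) := fun y hy =>
    h.dsPerp_eq hL hσ hy (h.curvatureVector_eq hL hσ) (h.deriv_curvature y hy)
  rw [h.dsPerp_eq hL hσ hx' h1 (h.deriv_ds_curvature hx'), h.curvatureVector_eq hL hσ hx',
    norm_smul, norm_rotL, h.norm_eq_one x hx', mul_one, Real.norm_eq_abs, sq_abs]
  module

end IsElastica

/-! ### Reparametrization by normalized arclength -/

/-- The normalized arclength and its inverse. -/
theorem exists_arclength {θ : ℝ → ℝ} (hθ : ContinuousOn θ (Icc 0 1))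
    (hpos : ∀ x ∈ Icc (0 : ℝ) 1, 0 < θ x) :
    ∃ (L : ℝ) (φ ψ : ℝ → ℝ), 0 < L ∧ ContDiff ℝ 1 φ ∧
      (∀ x ∈ Icc (0 : ℝ) 1, HasDerivAt φ (θ x / L) x) ∧ φ 0 = 0 ∧ φ 1 = 1 ∧
      (∀ x, ψ (φ x) = x) ∧ MapsTo ψ (Icc 0 1) (Icc 0 1) ∧
      (∀ y ∈ Icc (0 : ℝ) 1, HasDerivAt ψ (L / θ (ψ y)) y) := by
  -- The constant extension stays continuous and bounded below on the line, so `φ` is a bijection of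
  -- `ℝ` whose inverse has two-sided derivatives at `0` and `1`.
  set g : ℝ → ℝ := IccExtend (zero_le_one (α := ℝ)) ((Icc 0 1).domRestrict θ) with hg
  have hgc : Continuous g := continuous_IccExtend_iff.2 hθ.domRestrict
  have hgf : ∀ y ∈ Icc (0 : ℝ) 1, g y = θ y := fun y hy => by
    rw [hg, IccExtend_of_mem _ _ hy]; rfl
  obtain ⟨x0, hx0, hmin⟩ := isCompact_Icc.exists_isMinOn
    (nonempty_Icc.2 (zero_le_one (α := ℝ))) hθ
  set m := θ x0
  have hm : 0 < m := hpos x0 hx0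
  have hgm : ∀ y, m ≤ g y := fun y => hmin (projIcc (0 : ℝ) 1 zero_le_one y).2
  set L := ∫ x in (0 : ℝ)..1, g x with hL
  have hL0 : 0 < L := intervalIntegral.intervalIntegral_pos_of_pos (hgc.intervalIntegrable 0 1)
    (fun x => hm.trans_le (hgm x)) zero_lt_one
  set φ : ℝ → ℝ := fun x => (∫ y in (0 : ℝ)..x, g y) / L with hφ
  have hφd : ∀ x, HasDerivAt φ (g x / L) x := fun x =>
    (hgc.integral_hasStrictDerivAt 0 x).hasDerivAt.div_const L
  have hφd' : deriv φ = fun x => g x / L := funext fun x => (hφd x).deriv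
  have hφc : ContDiff ℝ 1 φ := by
    rw [contDiff_one_iff_deriv, hφd']
    exact ⟨fun x => (hφd x).differentiableAt, hgc.div_const L⟩
  have hmono : StrictMono φ := strictMono_of_deriv_pos fun x => by
    rw [hφd']; exact div_pos (hm.trans_le (hgm x)) hL0
  have h0 : φ 0 = 0 := by simp [hφ]
  have h1 : φ 1 = 1 := div_self hL0.ne'
  have hgrow : ∀ ⦃x y⦄, x ≤ y → m / L * (y - x) ≤ φ y - φ x :=
    mul_sub_le_image_sub_of_le_deriv hφc.differentiable_one fun x => by
      rw [hφd']; exact div_le_div_of_nonneg_right (hgm x) hL0.le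
  have hmL : 0 < m / L := div_pos hm hL0
  have hsurj : Function.Surjective φ := by
    refine hφc.continuous.surjective ?_ ?_
    · refine tendsto_atTop_mono' _ ?_ (tendsto_id.const_mul_atTop hmL)
      filter_upwards [eventually_ge_atTop 0] with x hx
      have := hgrow hx
      simpa [h0] using this
    · refine tendsto_atBot_mono' _ ?_ (tendsto_id.const_mul_atBot hmL)
      filter_upwards [eventually_le_atBot 0] with x hx
      have := hgrow hx
      simp only [h0, id] at this ⊢
      linarith
  set e := hmono.orderIsoOfSurjective φ hsurj with he
  have hl : ∀ x, e.symm (φ x) = x := fun x => e.symm_apply_apply x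
  have hr : ∀ y, φ (e.symm y) = y := fun y => e.apply_symm_apply y
  have hmaps : MapsTo e.symm (Icc 0 1) (Icc 0 1) := fun y hy => by
    have a0 := hl 0
    have a1 := hl 1
    rw [h0] at a0
    rw [h1] at a1
    have b0 := e.symm.monotone hy.1
    have b1 := e.symm.monotone hy.2
    rw [a0] at b0
    rw [a1] at b1
    exact ⟨b0, b1⟩
  refine ⟨L, φ, e.symm, hL0, hφc, fun x hx => hgf x hx ▸ hφd x, h0, h1, hl, hmaps, fun y hy => ?_⟩
  have hne : g (e.symm y) / L ≠ 0 := (div_pos (hm.trans_le (hgm _)) hL0).ne'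
  have := HasDerivAt.of_local_left_inverse e.symm.continuous.continuousAt (hφd (e.symm y)) hne
    (Eventually.of_forall hr)
  rwa [inv_div, hgf _ (hmaps hy)] at this

/-- A curve of class `H²` that solves the elastica equations has a smooth parametrization. -/
theorem IsH2Data.exists_smoothParametrization {γ P G : ℝ → Plane} (h : IsH2Data γ P G) {δ : ℝ}
    {c : Plane} {K : ℝ → ℝ}
    (hE : IsElastica δ c (fun x => ‖P x‖) K (fun x => ‖P x‖⁻¹ • P x)) :
    ∃ σ : ℝ → Plane, IsSmoothParametrization σ γ ∧ VectorEulerLagrange δ σ ∧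
      ScalarEulerLagrange δ σ ∧ ∀ b : Bool,
        tangent σ (endParam b) = ‖P (endParam b)‖⁻¹ • P (endParam b) ∧
        curvature σ (endParam b) = K (endParam b) ∧
        ds σ (curvature σ) (endParam b) =
          inner ℝ c (rotL (‖P (endParam b)‖⁻¹ • P (endParam b))) / 2 := by
  obtain ⟨L, φ, ψ, hL, hφ, hφd, h0, h1, hl, hmaps, hψd⟩ :=
    exists_arclength h.ac.continuousOn.norm fun x hx => norm_pos_iff.2 (h.ne_zero x hx)
  set T : ℝ → Plane := fun x => ‖P x‖⁻¹ • P x with hT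
  have hn : ∀ y ∈ Icc (0 : ℝ) 1, ‖P (ψ y)‖ ≠ 0 := fun y hy =>
    norm_ne_zero_iff.2 (h.ne_zero _ (hmaps hy))
  -- The chain rule contributes the factor `L / ‖P (ψ y)‖`, which replaces the speed by `L`; the
  -- force `c` is unchanged.
  have hE' : IsElastica δ c (fun _ => L) (K ∘ ψ) (T ∘ ψ) := by
    refine ⟨fun y hy => hE.norm_eq_one _ (hmaps hy), fun y hy => ?_, fun y hy => ?_,
      fun y hy => hE.force_tangent _ (hmaps hy)⟩
    · refine ((hE.deriv_tangent _ (hmaps hy)).scomp y (hψd y hy).hasDerivWithinAt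
        hmaps).congr_deriv ?_
      rw [smul_smul]
      congr 1
      have := hn y hy
      simp only [Function.comp]
      field_simp
    · refine ((hE.deriv_curvature _ (hmaps hy)).comp y (hψd y hy).hasDerivWithinAt
        hmaps).congr_deriv ?_
      have := hn y hy
      simp only [Function.comp]
      field_simp
  have hσ : ∀ y ∈ Icc (0 : ℝ) 1, HasDerivWithinAt (γ ∘ ψ) (L • (T ∘ ψ) y) (Icc 0 1) y := by
    intro y hy
    refine ((h.hasDerivWithinAt _ (hmaps hy)).scomp y (hψd y hy).hasDerivWithinAt
      hmaps).congr_deriv ?_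
    simp only [Function.comp, hT, smul_smul, div_eq_mul_inv]
  have hu : UniqueDiffOn ℝ (Icc (0 : ℝ) 1) := uniqueDiffOn_Icc zero_lt_one
  refine ⟨γ ∘ ψ, ⟨?_, fun x hx => ?_, φ, hφ.contDiffOn, fun x hx => ?_, h0, h1, fun x hx => ?_⟩,
    hE'.vectorEulerLagrange hL hσ, hE'.scalarEulerLagrange hL hσ, fun b => ?_⟩
  · rw [contDiffOn_infty_iff_derivWithin hu]
    exact ⟨fun x hx => (hσ x hx).differentiableWithinAt,
      (hE'.contDiffOn.const_smul L).congr fun x hx => (hσ x hx).derivWithin (hu x hx)⟩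
  · exact norm_ne_zero_iff.1 ((hE'.dx_curve hL hσ hx).2.symm ▸ hL.ne')
  · rw [ElasticNetwork.dx_eq hx (hφd x hx).hasDerivWithinAt]
    exact div_pos (norm_pos_iff.2 (h.ne_zero x hx)) hL
  · simp only [Function.comp, hl]
  · have hb : endParam b ∈ Icc (0 : ℝ) 1 := by cases b <;> simp [endParam]
    have hψb : ψ (endParam b) = endParam b := by
      have a0 := hl 0
      have a1 := hl 1
      rw [h0] at a0
      rw [h1] at a1
      cases b <;> simpa [endParam]
    rw [hE'.tangent_eq hL hσ hb, hE'.curvature_eq hL hσ hb, hE'.ds_curvature_eq hL hσ hb]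
    simp only [Function.comp, hψb, hT, and_self]

/-! ### Variations of the network and conditions at the junctions -/

/-- Cubic Hermite interpolation. -/
theorem exists_hermite (a₀ a₁ b₀ b₁ : Plane) : ∃ ψ : ℝ → Plane, ContDiff ℝ ∞ ψ ∧
    ψ 0 = a₀ ∧ ψ 1 = a₁ ∧ deriv ψ 0 = b₀ ∧ deriv ψ 1 = b₁ := by
  -- The conditions at `1` read `c₂ + c₃ = a₁ - a₀ - b₀` and `2 c₂ + 3 c₃ = b₁ - b₀`.
  set c₂ := (3 : ℝ) • (a₁ - a₀) - (2 : ℝ) • b₀ - b₁ with hc₂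
  set c₃ := (2 : ℝ) • (a₀ - a₁) + b₀ + b₁ with hc₃
  have hd : ∀ x : ℝ, HasDerivAt (fun x : ℝ => a₀ + x • b₀ + x ^ 2 • c₂ + x ^ 3 • c₃)
      (b₀ + (2 * x) • c₂ + (3 * x ^ 2) • c₃) x := fun x => by
    have := ((((hasDerivAt_id x).smul_const b₀).const_add a₀).add
      ((hasDerivAt_pow 2 x).smul_const c₂)).add ((hasDerivAt_pow 3 x).smul_const c₃)
    exact this.congr_deriv (by simp)
  refine ⟨fun x : ℝ => a₀ + x • b₀ + x ^ 2 • c₂ + x ^ 3 • c₃, by fun_prop, by simp, ?_, by rw [(hd 0).deriv]; simp, ?_⟩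
  · rw [hc₂, hc₃]
    module
  · rw [(hd 1).deriv, hc₂, hc₃]
    module

theorem norm_add_smul_rotL (s : ℝ) (q : Plane) :
    ‖q + s • rotL q‖ = Real.sqrt (1 + s ^ 2) * ‖q‖ := by
  rw [← sq_eq_sq₀ (norm_nonneg _) (by positivity), mul_pow, Real.sq_sqrt (by positivity),
    norm_sq_eq_coord, norm_sq_eq_coord]
  simp
  ring

/-- `1 + s J` is a rotation times the factor `√(1 + s²)`, so it keeps angles exactly and not just to
first order. Variations linear in `t` can therefore respect the angle constraint. -/
theorem angle_add_smul_rotL (s : ℝ) (q r : Plane) :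
    InnerProductGeometry.angle (q + s • rotL q) (r + s • rotL r) =
      InnerProductGeometry.angle q r := by
  have hs : (1 + s ^ 2 : ℝ) ≠ 0 := by positivity
  have h1 : inner ℝ (q + s • rotL q) (r + s • rotL r) = (1 + s ^ 2) * inner ℝ q r := by
    simp [inner_eq_coord]; ring
  have h2 : Real.sqrt (1 + s ^ 2) * ‖q‖ * (Real.sqrt (1 + s ^ 2) * ‖r‖)
      = (1 + s ^ 2) * (‖q‖ * ‖r‖) := by
    rw [mul_mul_mul_comm, Real.mul_self_sqrt (by positivity)]
  rw [InnerProductGeometry.angle, InnerProductGeometry.angle, h1, norm_add_smul_rotL,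
    norm_add_smul_rotL, h2, mul_div_mul_left _ _ hs]

theorem endParam_mem (b : Bool) : endParam b ∈ Icc (0 : ℝ) 1 := by cases b <;> simp [endParam]

theorem firstVariation_zero (δ : ℝ) (P G : ℝ → Plane) :
    firstVariation δ P G (fun _ => 0) = 0 := by
  simp [firstVariation]

variable {N : ℕ} {J : Type*} {junction : CurveEnd N → J} {γ : Fin N → ℝ → Plane}
  {G : Fin N → ℝ → Plane} {δ : ℝ}

theorem angle_outwardTangent (γ : Fin N → ℝ → Plane) {e e' : CurveEnd N}
    (h : dx (γ e.1) (endParam e.2) ≠ 0) (h' : dx (γ e'.1) (endParam e'.2) ≠ 0) :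
    InnerProductGeometry.angle (outwardTangent γ e) (outwardTangent γ e') =
      InnerProductGeometry.angle (outward e.2 • dx (γ e.1) (endParam e.2))
        (outward e'.2 • dx (γ e'.1) (endParam e'.2)) := by
  rw [outwardTangent, outwardTangent, tangent, tangent, ds, ds, smul_comm (outward e.2),
    smul_comm (outward e'.2),
    InnerProductGeometry.angle_smul_left_of_pos _ _ (inv_pos.2 (norm_pos_iff.2 h)),
    InnerProductGeometry.angle_smul_right_of_pos _ _ (inv_pos.2 (norm_pos_iff.2 h'))]

/-- The first variation vanishes for smooth fields that translate each junction by `v` and rotate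
its tangents with angular velocity `rate`. -/
theorem sum_firstVariation_eq_zero (hγ : IsRegularH2Network junction γ)
    (hG : ∀ i, IsH2Data (γ i) (dx (γ i)) (G i)) (hstat : IsStationaryFixedAngles δ junction γ)
    {ψ : Fin N → ℝ → Plane} (hψ : ∀ i, ContDiff ℝ ∞ (ψ i)) (v : J → Plane) (rate : J → ℝ)
    (hv : ∀ e : CurveEnd N, ψ e.1 (endParam e.2) = v (junction e))
    (hrate : ∀ e : CurveEnd N, deriv (ψ e.1) (endParam e.2) =
      rate (junction e) • rotL (dx (γ e.1) (endParam e.2))) :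
    ∑ i, firstVariation δ (dx (γ i)) (G i) (ψ i) = 0 := by
  set η : Fin N → ℝ → ℝ → Plane := fun i t x => t • ψ i x with hη
  have hvar : IsVariation junction γ η := by
    refine ⟨fun i => ?_, fun i x => zero_smul _ _, Eventually.of_forall fun t e e' hee => ?_⟩
    · exact contDiff_fst.smul ((hψ i).comp contDiff_snd)
    · simp only [perturb, hη, hv, hee, hγ.attached e e' hee]
  have hdx : ∀ (t : ℝ) (e : CurveEnd N), dx (perturb γ η t e.1) (endParam e.2) =
      dx (γ e.1) (endParam e.2)
        + (t * rate (junction e)) • rotL (dx (γ e.1) (endParam e.2)) := by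
    intro t e
    have hb := endParam_mem e.2
    have hd := (((hψ e.1).differentiable (by simp)) (endParam e.2)).hasDerivAt
    have hd' : HasDerivWithinAt (perturb γ η t e.1) _ (Icc 0 1) (endParam e.2) :=
      ((hG e.1).hasDerivWithinAt _ hb).add (hd.const_smul t).hasDerivWithinAt
    rw [dx_eq hb hd', hrate, smul_smul]
  have hne : ∀ (t : ℝ) (e : CurveEnd N), dx (perturb γ η t e.1) (endParam e.2) ≠ 0 := by
    intro t e
    have hn := norm_pos_iff.2 (hγ.isRegular e.1 _ (endParam_mem e.2))
    rw [hdx, ← norm_pos_iff, norm_add_smul_rotL]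
    positivity
  have hang : ∀ t, SameAngles junction γ (perturb γ η t) := by
    intro t e e' hee
    rw [angle_outwardTangent _ (hne t e) (hne t e'), angle_outwardTangent _
      (hγ.isRegular e.1 _ (endParam_mem e.2)) (hγ.isRegular e'.1 _ (endParam_mem e'.2)),
      hdx, hdx, ← hee]
    -- All velocities at the junction undergo one and the same similarity, which commutes with the
    -- orientation signs.
    have hcomm : ∀ (a s : ℝ) (q : Plane), a • (q + s • rotL q) = a • q + s • rotL (a • q) :=
      fun a s q => by rw [map_smul, smul_add, smul_comm]
    rw [hcomm, hcomm, angle_add_smul_rotL]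
  have h1 := hstat η hvar (Eventually.of_forall hang)
  have h2 : HasDerivAt (fun t => energy δ (perturb γ η t))
      (∑ i, firstVariation δ (dx (γ i)) (G i) (ψ i)) 0 := by
    have := HasDerivAt.fun_sum (u := Finset.univ) fun i _ => (hG i).hasDerivAt_energy δ (hψ i)
    refine this.congr_of_eventuallyEq (Eventually.of_forall fun t => ?_)
    simp only [energy, Finset.mul_sum, ← Finset.sum_add_distrib]
    rfl
  exact h2.unique h1

/-- Extended by zero to the other curves, such a field moves no end point and turns no end tangent,
so it is admissible with zero translation and zero rate. -/
theorem firstVariation_eq_zero_of_isFlatTest (hγ : IsRegularH2Network junction γ)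
    (hG : ∀ i, IsH2Data (γ i) (dx (γ i)) (G i)) (hstat : IsStationaryFixedAngles δ junction γ)
    (i : Fin N) {ψ : ℝ → Plane} (hψ : IsFlatTest ψ) :
    firstVariation δ (dx (γ i)) (G i) ψ = 0 := by
  have hz : ∀ j, j ≠ i → (if j = i then ψ else fun _ => 0) = fun _ => (0 : Plane) :=
    fun j hj => if_neg hj
  have := sum_firstVariation_eq_zero hγ hG hstat
    (ψ := fun j => if j = i then ψ else fun _ => 0)
    (fun j => by
      by_cases hj : j = i
      · simpa [hj] using hψ.smooth
      · rw [hz j hj]; exact contDiff_const)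
    (fun _ => 0) (fun _ => 0)
    (fun ⟨j, b⟩ => by
      by_cases hj : j = i
      · cases b <;> simp [hj, endParam, hψ.zero, hψ.one]
      · simp [hj])
    (fun ⟨j, b⟩ => by
      by_cases hj : j = i
      · cases b <;> simp [hj, endParam, hψ.deriv_zero, hψ.deriv_one]
      · simp [hj])
  rw [Finset.sum_eq_single i (fun j _ hj => by rw [hz j hj, firstVariation_zero])
    (fun h => absurd (Finset.mem_univ i) h), if_pos rfl] at this
  exact this

/-- The balance of the forces `c` and of the moments `K` at the junctions. -/
theorem junction_balance (hγ : IsRegularH2Network junction γ)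
    (hG : ∀ i, IsH2Data (γ i) (dx (γ i)) (G i)) (hstat : IsStationaryFixedAngles δ junction γ)
    {c : Fin N → Plane} {K : Fin N → ℝ → ℝ}
    (hFV : ∀ i ψ, ContDiff ℝ ∞ ψ → firstVariation δ (dx (γ i)) (G i) ψ =
        inner ℝ ((2 * K i 1 / ‖dx (γ i) 1‖ ^ 2) • rotL (dx (γ i) 1)) (deriv ψ 1)
        - inner ℝ ((2 * K i 0 / ‖dx (γ i) 0‖ ^ 2) • rotL (dx (γ i) 0)) (deriv ψ 0)
        - inner ℝ (c i) (ψ 1 - ψ 0)) (v : J → Plane) (rate : J → ℝ) :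
    ∑ e : CurveEnd N, outward e.2 *
      (inner ℝ (c e.1) (v (junction e)) - 2 * K e.1 (endParam e.2) * rate (junction e)) = 0 := by
  -- Interpolation realizes any translations and turning rates of the junctions, also when both ends
  -- of a curve lie in the same one.
  have hex : ∀ i, ∃ ψ : ℝ → Plane, ContDiff ℝ ∞ ψ ∧
      ψ 0 = v (junction (i, false)) ∧ ψ 1 = v (junction (i, true)) ∧
      deriv ψ 0 = rate (junction (i, false)) • rotL (dx (γ i) 0) ∧
      deriv ψ 1 = rate (junction (i, true)) • rotL (dx (γ i) 1) := fun i => exists_hermite _ _ _ _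
  choose ψ hψ h0 h1 d0 d1 using hex
  have hs := sum_firstVariation_eq_zero hγ hG hstat hψ v rate
    (fun ⟨i, b⟩ => by cases b <;> simp [endParam, h0, h1])
    (fun ⟨i, b⟩ => by cases b <;> simp [endParam, d0, d1])
  rw [← hs, Fintype.sum_prod_type]
  refine Finset.sum_congr rfl fun i _ => ?_
  have n0 := norm_ne_zero_iff.2 (hγ.isRegular i 0 (by simp))
  have n1 := norm_ne_zero_iff.2 (hγ.isRegular i 1 (by simp))
  rw [hFV i _ (hψ i), d0, d1, h0, h1, Fintype.sum_bool]
  simp only [outward, endParam, if_true, real_inner_smul_left, real_inner_smul_right,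
    real_inner_self_eq_norm_sq, norm_rotL, inner_sub_right, Bool.false_eq_true, if_false]
  field_simp
  ring

theorem norm_outwardTangent (hγ : IsRegularH2Network junction γ) (e : CurveEnd N) :
    ‖outwardTangent γ e‖ = 1 := by
  have hn := norm_ne_zero_iff.2 (hγ.isRegular e.1 _ (endParam_mem e.2))
  have ho : |outward e.2| = 1 := by cases e.2 <;> simp [outward]
  rw [outwardTangent, tangent, ds, norm_smul, norm_smul, norm_inv, norm_norm, inv_mul_cancel₀ hn,
    Real.norm_eq_abs, ho, mul_one]

/-- The outward tangents at a triple junction with equal angles add up to zero. -/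
theorem sum_outwardTangent_eq_zero (hγ : IsRegularH2Network junction γ) {o : J}
    (ho : IsEqualAngleTriple junction γ o) :
    ∑ e ∈ endsAt junction o, outwardTangent γ e = 0 := by
  -- In the squared norm of the sum each tangent contributes `1 + 2 · (-1/2) = 0`.
  rw [← norm_eq_zero, ← sq_eq_zero_iff, ← real_inner_self_eq_norm_sq, sum_inner]
  refine Finset.sum_eq_zero fun e he => ?_
  rw [inner_sum, ← Finset.add_sum_erase _ _ he, real_inner_self_eq_norm_sq,
    norm_outwardTangent hγ]
  have h1 : ∀ e' ∈ (endsAt junction o).erase e,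
      inner ℝ (outwardTangent γ e) (outwardTangent γ e') = -1 / 2 := by
    intro e' he'
    obtain ⟨hne, hm⟩ := Finset.mem_erase.1 he'
    rw [← InnerProductGeometry.cos_angle_mul_norm_mul_norm, ho.2 e he e' hm hne.symm,
      norm_outwardTangent hγ, norm_outwardTangent hγ,
      show 2 * Real.pi / 3 = Real.pi - Real.pi / 3 by ring, Real.cos_pi_sub, Real.cos_pi_div_three]
    norm_num
  rw [Finset.sum_congr rfl h1, Finset.sum_const, Finset.card_erase_of_mem he, ho.1]
  norm_num

/-- Networks that are stationary with fixed angles solve the Euler–Lagrange equations, with the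
natural boundary conditions at equal-angle triple junctions. -/
theorem IsStationaryFixedAngles.eulerLagrange (hγ : IsRegularH2Network junction γ)
    (hstat : IsStationaryFixedAngles δ junction γ) :
    ∃ σ : Fin N → ℝ → Plane,
      (∀ i, IsSmoothParametrization (σ i) (γ i) ∧
        VectorEulerLagrange δ (σ i) ∧ ScalarEulerLagrange δ (σ i)) ∧
      ∀ o : J, IsEqualAngleTriple junction γ o → JunctionConditions junction σ o := by
  classical
  choose G hG using fun i => exists_isH2Data (hγ.isH2 i) (hγ.isRegular i)
  choose c K hE hFV using fun i => (hG i).exists_isElastica (δ := δ) fun ψ hψ =>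
    firstVariation_eq_zero_of_isFlatTest hγ hG hstat i hψ
  choose σ hσ hvec hsc hend using fun i => (hG i).exists_smoothParametrization (hE i)
  have hbal := junction_balance hγ hG hstat hFV
  refine ⟨σ, fun i => ⟨hσ i, hvec i, hsc i⟩, fun o ho => ⟨?_, ?_⟩⟩
  -- Turn the tangents at `o` at unit rate without moving any junction; the moments enter with the
  -- factor `-2`.
  · have := hbal 0 (Pi.single o 1)
    replace this := congrArg (fun r : ℝ => -(1 / 2) * r) this
    simp only [Finset.mul_sum, mul_zero] at this
    rw [endsAt, Finset.sum_filter]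
    refine Eq.trans ?_ this
    refine Finset.sum_congr rfl fun e _ => ?_
    rw [(hend e.1 e.2).2.1]
    by_cases h : junction e = o
    · simp [h]; ring
    · simp [h]
  -- Translate `o` alone in an arbitrary direction `u`, turning nothing.
  · have hc : ∑ e ∈ endsAt junction o, outward e.2 • c e.1 = 0 := by
      refine ext_inner_right ℝ fun u => ?_
      have := hbal (Pi.single o u) 0
      rw [inner_zero_left, sum_inner, endsAt, Finset.sum_filter]
      refine Eq.trans ?_ this
      refine Finset.sum_congr rfl fun e _ => ?_
      by_cases h : junction e = o
      · simp [h, real_inner_smul_left]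
      · simp [h]
    have hT := sum_outwardTangent_eq_zero hγ ho
    have key : ∀ e ∈ endsAt junction o, outward e.2 •
        ((2 * ds (σ e.1) (curvature (σ e.1)) (endParam e.2)) • normal (σ e.1) (endParam e.2)
          + curvature (σ e.1) (endParam e.2) ^ 2 • tangent (σ e.1) (endParam e.2))
        = outward e.2 • c e.1 + δ • outwardTangent γ e := by
      intro e _
      have hb := endParam_mem e.2
      have h1 := (hE e.1).norm_eq_one _ hb
      have h2 := (hE e.1).force_tangent _ hb
      obtain ⟨t1, t2, t3⟩ := hend e.1 e.2
      have h3 : tangent (γ e.1) (endParam e.2)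
          = ‖dx (γ e.1) (endParam e.2)‖⁻¹ • dx (γ e.1) (endParam e.2) := rfl
      simp only [normal]
      rw [t3, t2, t1, outwardTangent, h3, ← rotL_apply]
      generalize ‖dx (γ e.1) (endParam e.2)‖⁻¹ • dx (γ e.1) (endParam e.2) = T at h1 h2 ⊢
      -- In the frame `T, rotL T` the force is `c = (k² - δ) T + 2 ∂ₛk rotL T`, so the summand is `c
      -- + δ T` up to the orientation sign.
      have h4 := norm_sq_smul_eq T (c e.1)
      rw [h1, one_pow, one_smul, real_inner_comm, h2, real_inner_comm] at h4
      conv_rhs => rw [h4]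
      module
    rw [Finset.sum_congr rfl key, Finset.sum_add_distrib, hc, ← Finset.smul_sum, hT]
    simp

end ElasticNetwork

end

open ElasticNetwork
theorem mainTheorem2 {N : ℕ} {J : Type*} (δ : ℝ) (hδ : 0 < δ)
    (junction : CurveEnd N → J) (γ : Fin N → ℝ → Plane)
    (hγ : IsRegularH2Network junction γ) :
    (IsFreelyStationary δ junction γ →
      ∃ σ : Fin N → ℝ → Plane, ∀ i, IsSmoothParametrization (σ i) (γ i) ∧
        VectorEulerLagrange δ (σ i) ∧ ScalarEulerLagrange δ (σ i)) ∧
    (IsStationaryFixedAngles δ junction γ →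
      ∃ σ : Fin N → ℝ → Plane,
        (∀ i, IsSmoothParametrization (σ i) (γ i) ∧
          VectorEulerLagrange δ (σ i) ∧ ScalarEulerLagrange δ (σ i)) ∧
        ∀ o : J, IsEqualAngleTriple junction γ o → JunctionConditions junction σ o) := by
  refine ⟨fun h => ?_, fun h => h.eulerLagrange hγ⟩
  have hfix : IsStationaryFixedAngles δ junction γ := fun η hη _ => h η hη
  obtain ⟨σ, hσ, _⟩ := hfix.eulerLagrange hγ
  exact ⟨σ, hσ⟩
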